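/- \textbf{Language.} Let $Prop$ be a countably infinite set of propositional variables and let $Fm$ be the set of formulas built from $Prop$ with the constant $\bar 0$, the binary connectives $*$, $\to$ and the unary connectives $\square$, $\lozenge$. As usual, $\neg\varphi := \varphi\to\bar 0$, $\bar 1:=\bar 0\to\bar 0$, $\varphi\wedge\psi := \varphi*(\varphi\to\psi)$, $\varphi\vee\psi := ((\varphi\to\psi)\to\psi)\wedge((\psi\to\varphi)\to\varphi)$, $\varphi\equiv\psi := (\varphi\to\psi)\wedge(\psi\to\varphi)$, and $\varphi^n := \varphi*\cdots*\varphi$ ($n$ factors; $\varphi^0:=\bar 1$). \textbf{Calculus.} $\mathrm{S5}(\mathcal{L})$ has as axioms all instances, for formulas of $Fm$, of the axiom schemata of infinite-valued \L ukasiewicz logic $\mathcal{L}$ (H\'ajek's axioms of Basic Logic together with $\neg\neg\varphi\to\varphi$) and of the schemata \[ \square\varphi\to\varphi,\qquad \varphi\to\lozenge\varphi,\qquad \square(\nu\to\varphi)\to(\nu\to\square\varphi),\qquad \square(\varphi\to\nu)\to(\lozenge\varphi\to\nu), \] \[ \square(\varphi\vee\nu)\to(\square\varphi\vee\nu),\qquad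 \lozenge(\varphi*\varphi)\equiv(\lozenge\varphi)*(\lozenge\varphi), \] where $\varphi$ is any formula and $\nu$ is any propositional combination of formulas beginning with $\square$ or $\lozenge$; its rules are Modus Ponens (from $\varphi$ and $\varphi\to\psi$ infer $\psi$) and Necessitation (from $\varphi$ infer $\square\varphi$). The logic $\mathrm{S5}(\mathcal{L})_\infty$ is obtained by adding the infinitary rule: from all the formulas $\square\varphi\vee(\square\alpha\to(\square\beta)^n)$, $n\in\mathbb{N}$, infer $\square\varphi\vee(\square\alpha\to\square\alpha*\square\beta)$. For a natural number $k$, the logic $\mathrm{S5}_k(\mathcal{L})_\infty$ is obtained from $\mathrm{S5}(\mathcal{L})_\infty$ by adding all instances of the axiom schema \[ \bigwedge_{1\le i<j\le k+1}\square(\varphi_i\vee\varphi_j)\to\bigvee_{i=1}^{k+1}\square\varphi_i \tag{$W_k$} \] (an empty conjunction is $\bar 1$). For $\Gamma\cup\{\varphi\}\subseteq Fm$, write $\Gamma\vdash_{\mathrm{S5}_k(\mathcal{L})_\infty}\varphi$ if there are an ordinal $\xi$ and a family of formulas $(\psi_i)_{i\le\xi}$ with $\psi_\xi=\varphi$ such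 that, for each $i\le\xi$, $\psi_i$ is an axiom, or belongs to $\Gamma$, or is the lower formula of an instance of a rule all of whose upper formulas are in $\{\psi_j: j<i\}$. \textbf{Semantics.} Consider structures $\mathbf{K}=\langle X,e,[0,1]\rangle$, where $X$ is a non-empty set and $e\colon X\times Prop\to[0,1]$. Truth values $\|\cdot\|_{\mathbf{K},x}\in[0,1]$, $x\in X$, are defined by $\|p\|_{\mathbf{K},x}=e(x,p)$, $\|\bar 0\|_{\mathbf{K},x}=0$, by interpreting $*$ as $a*b=\max(a+b-1,0)$ and $\to$ as $a\to b=\min(1-a+b,1)$, and by $\|\square\psi\|_{\mathbf{K},x}=\inf_{x'\in X}\|\psi\|_{\mathbf{K},x'}$ and $\|\lozenge\psi\|_{\mathbf{K},x}=\sup_{x'\in X}\|\psi\|_{\mathbf{K},x'}$. $\mathbf{K}$ is a model of a set of formulas if all of them have value $1$ at every $x\in X$. Write $\Gamma\vDash_{\mathrm{S5}_k([0,1]_{\text{\L}})}\varphi$ if every model $\mathbf{K}$ of $\Gamma$ with $|X|\le k$ is a model of $\{\varphi\}$. \textbf{Theorem.} Let $k$ be a natural number and let $\Gamma\cup\{\varphi\}\subseteq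 Fm$ ($\Gamma$ possibly infinite). Then \[ \Gamma\vdash_{\mathrm{S5}_k(\mathcal{L})_\infty}\varphi \quad\text{if and only if}\quad \Gamma\vDash_{\mathrm{S5}_k([0,1]_{\text{\L}})}\varphi . \] -/

import Mathlib

universe u v

namespace S5Luk

/-! Syntax -/

/-- Formulas in the language of Basic Logic (falsum, strong conjunction, implication; the other
propositional connectives are the usual abbreviations) expanded with the two unary connectives
box and diamond, over a set `V` of propositional variables. -/
inductive Fm (V : Type*) : Type _
  | var (p : V) : Fm V
  | bot : Fm V
  | mul (φ ψ : Fm V) : Fm V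
  | imp (φ ψ : Fm V) : Fm V
  | box (φ : Fm V) : Fm V
  | dia (φ : Fm V) : Fm V

namespace Fm

variable {V : Type*}

/-- Negation `φ → 0`. -/
def neg (φ : Fm V) : Fm V := φ.imp bot

/-- The constant `1`, that is `0 → 0`. -/
def top : Fm V := imp bot bot

/-- Lattice conjunction `φ * (φ → ψ)`. -/
def and (φ ψ : Fm V) : Fm V := φ.mul (φ.imp ψ)

/-- Lattice disjunction `((φ → ψ) → ψ) ∧ ((ψ → φ) → φ)`. -/
def or (φ ψ : Fm V) : Fm V := ((φ.imp ψ).imp ψ).and ((ψ.imp φ).imp φ)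

/-- The abbreviation `φ ≡ ψ`, that is `(φ → ψ) ∧ (ψ → φ)`. -/
def equ (φ ψ : Fm V) : Fm V := (φ.imp ψ).and (ψ.imp φ)

/-- The power `φ * ⋯ * φ` (`n` factors), equal to `1` for `n = 0`. -/
def pow (φ : Fm V) : ℕ → Fm V
  | 0 => top
  | 1 => φ
  | n + 2 => (pow φ (n + 1)).mul φ

/-- Lattice conjunction of a finite list (`1` for the empty list). -/
def bigAnd : List (Fm V) → Fm V
  | [] => top
  | [φ] => φ
  | φ :: ψ :: l => φ.and (bigAnd (ψ :: l))

/-- Lattice disjunction of a finite list (`0` for the empty list). -/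
def bigOr : List (Fm V) → Fm V
  | [] => bot
  | [φ] => φ
  | φ :: ψ :: l => φ.or (bigOr (ψ :: l))

end Fm

variable {V : Type*}

local infixr:55 " ⟹ " => Fm.imp
local infixl:65 " ⊛ " => Fm.mul
local infixr:60 " ⋎ " => Fm.or
local prefix:max "◻" => Fm.box
local prefix:max "◇" => Fm.dia

/-- Propositional combinations of formulas beginning with box or diamond. -/
inductive IsModalComb : Fm V → Prop
  | box (φ : Fm V) : IsModalComb (◻φ)
  | dia (φ : Fm V) : IsModalComb (◇φ)
  | bot : IsModalComb Fm.bot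
  | mul {μ ν : Fm V} : IsModalComb μ → IsModalComb ν → IsModalComb (μ ⊛ ν)
  | imp {μ ν : Fm V} : IsModalComb μ → IsModalComb ν → IsModalComb (μ ⟹ ν)

/-! The calculi -/

/-- Instances of the axiom schemata of infinite-valued Łukasiewicz logic: Hájek's axioms of Basic
Logic together with double negation elimination. -/
inductive LukAx : Fm V → Prop
  | a1 (φ ψ χ : Fm V) : LukAx ((φ ⟹ ψ) ⟹ (ψ ⟹ χ) ⟹ (φ ⟹ χ))
  | a2 (φ ψ : Fm V) : LukAx ((φ ⊛ ψ) ⟹ φ)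
  | a3 (φ ψ : Fm V) : LukAx ((φ ⊛ ψ) ⟹ (ψ ⊛ φ))
  | a4 (φ ψ : Fm V) : LukAx ((φ ⊛ (φ ⟹ ψ)) ⟹ (ψ ⊛ (ψ ⟹ φ)))
  | a5a (φ ψ χ : Fm V) : LukAx ((φ ⟹ (ψ ⟹ χ)) ⟹ ((φ ⊛ ψ) ⟹ χ))
  | a5b (φ ψ χ : Fm V) : LukAx (((φ ⊛ ψ) ⟹ χ) ⟹ (φ ⟹ (ψ ⟹ χ)))
  | a6 (φ ψ χ : Fm V) : LukAx (((φ ⟹ ψ) ⟹ χ) ⟹ (((ψ ⟹ φ) ⟹ χ) ⟹ χ))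
  | a7 (φ : Fm V) : LukAx (Fm.bot ⟹ φ)
  | dne (φ : Fm V) : LukAx (φ.neg.neg ⟹ φ)

/-- Instances of the axiom schemata of `S5(Ł)`. -/
inductive S5Ax : Fm V → Prop
  | luk {φ : Fm V} : LukAx φ → S5Ax φ
  | boxElim (φ : Fm V) : S5Ax (◻φ ⟹ φ)
  | diaIntro (φ : Fm V) : S5Ax (φ ⟹ ◇φ)
  | boxImp {ν : Fm V} (hν : IsModalComb ν) (φ : Fm V) : S5Ax (◻(ν ⟹ φ) ⟹ (ν ⟹ ◻φ))
  | impDia {ν : Fm V} (hν : IsModalComb ν) (φ : Fm V) : S5Ax (◻(φ ⟹ ν) ⟹ (◇φ ⟹ ν))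
  | boxOr {ν : Fm V} (hν : IsModalComb ν) (φ : Fm V) : S5Ax (◻(φ ⋎ ν) ⟹ (◻φ ⋎ ν))
  | diaSq (φ : Fm V) : S5Ax (Fm.equ (◇(φ ⊛ φ)) (◇φ ⊛ ◇φ))

/-- The instance of the schema `(W_k)` given by `φ 0, …, φ k`:
`⋀_{i < j} ◻(φ i ∨ φ j) → ⋁_i ◻(φ i)`. -/
def wk (k : ℕ) (φ : Fin (k + 1) → Fm V) : Fm V :=
  Fm.bigAnd ((List.finRange (k + 1)).flatMap fun i =>
      ((List.finRange (k + 1)).filter fun j => i < j).map fun j => ◻(φ i ⋎ φ j)) ⟹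
    Fm.bigOr ((List.finRange (k + 1)).map fun i => ◻(φ i))

/-- The axioms of `S5_k(Ł)_∞`: those of `S5(Ł)_∞` (which are those of `S5(Ł)`) and all instances
of `(W_k)`. -/
inductive S5kAx (k : ℕ) : Fm V → Prop
  | s5 {φ : Fm V} : S5Ax φ → S5kAx k φ
  | width (φ : Fin (k + 1) → Fm V) : S5kAx k (wk k φ)

/-- `IsRule P φ`: `φ` is the lower formula, and `P` the set of upper formulas, of an instance of
Modus Ponens, Necessitation or the infinitary rule. -/
inductive IsRule : Set (Fm V) → Fm V → Prop
  | mp (φ ψ : Fm V) : IsRule {φ, φ ⟹ ψ} ψ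
  | nec (φ : Fm V) : IsRule {φ} (◻φ)
  | boxInf (φ α β : Fm V) :
      IsRule (Set.range fun n : ℕ => ◻φ ⋎ (◻α ⟹ Fm.pow (◻β) n))
        (◻φ ⋎ (◻α ⟹ (◻α ⊛ ◻β)))

/-- The sequence `ψ i`, `i ≤ ξ`, is a proof of `φ` from `Γ` in `S5_k(Ł)_∞`. Only the values of `ψ`
at ordinals `i ≤ ξ` matter. -/
structure IsProof (k : ℕ) (Γ : Set (Fm V)) (φ : Fm V) (ξ : Ordinal.{0})
    (ψ : Ordinal.{0} → Fm V) : Prop where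
  last : ψ ξ = φ
  step : ∀ i ≤ ξ, S5kAx k (ψ i) ∨ ψ i ∈ Γ ∨ ∃ P, IsRule P (ψ i) ∧ P ⊆ ψ '' Set.Iio i

/-- `Γ ⊢ φ` in `S5_k(Ł)_∞`: there is a proof, of possibly transfinite length, of `φ` from `Γ`. -/
def Provable (k : ℕ) (Γ : Set (Fm V)) (φ : Fm V) : Prop :=
  ∃ (ξ : Ordinal.{0}) (ψ : Ordinal.{0} → Fm V), IsProof k Γ φ ξ ψ

/-! Semantics over the standard MV-chain on the real unit interval -/

/-- The Łukasiewicz t-norm `max (a + b - 1) 0`. -/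
def tnorm (a b : unitInterval) : unitInterval :=
  ⟨max ((a : ℝ) + b - 1) 0, le_max_right _ _,
    max_le (by linarith [a.2.2, b.2.2]) zero_le_one⟩

/-- The residuum `min (1 - a + b) 1` of the Łukasiewicz t-norm. -/
def resid (a b : unitInterval) : unitInterval :=
  ⟨min (1 - (a : ℝ) + b) 1, le_min (by linarith [a.2.2, b.2.1]) zero_le_one, min_le_right _ _⟩

/-- A structure `⟨X, e, [0,1]⟩` with non-empty universe. -/
structure Struc (V : Type v) where
  X : Type u
  nonempty : Nonempty X
  e : X → V → unitInterval

/-- The truth value of a formula at a point. The unit interval is a complete chain, so that all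
infima and suprema exist and every structure is safe. -/
noncomputable def Struc.val (K : Struc V) : Fm V → K.X → unitInterval
  | .var p, x => K.e x p
  | .bot, _ => 0
  | .mul φ ψ, x => tnorm (K.val φ x) (K.val ψ x)
  | .imp φ ψ, x => resid (K.val φ x) (K.val ψ x)
  | .box φ, _ => ⨅ y, K.val φ y
  | .dia φ, _ => ⨆ y, K.val φ y

/-- `K` is a model of the set `Γ`. -/
def Struc.IsModel (K : Struc V) (Γ : Set (Fm V)) : Prop :=
  ∀ φ ∈ Γ, ∀ x : K.X, K.val φ x = 1

/-- `Γ ⊨ φ` in `S5_k([0,1]_Ł)`: every model of `Γ` with universe of size at most `k` is a model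
of `φ`. -/
def Entails {V : Type v} (k : ℕ) (Γ : Set (Fm V)) (φ : Fm V) : Prop :=
  ∀ K : Struc.{u, v} V, Cardinal.mk K.X ≤ (k : Cardinal.{u}) → K.IsModel Γ → K.IsModel {φ}

end S5Luk

namespace S5Luk

/-- Linearly ordered MV-algebras, in terms of the product and the negation. -/
class MVChain (A : Type*) extends CommMonoid A, LinearOrder A where
  nt : A → A
  nt_nt (a : A) : nt (nt a) = a
  le_one' (a : A) : a ≤ 1
  le_nt_mul (a b c : A) : a ≤ nt (b * c) ↔ a * b ≤ nt c
  mul_nt_mul_nt (a b : A) : a * nt (a * nt b) = min a b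

namespace MVChain

variable {A : Type*} [MVChain A]

/-- The strong disjunction of an MV-algebra. -/
def pl (a b : A) : A := nt (nt a * nt b)

theorem nt_pl (a b : A) : nt (pl a b) = nt a * nt b := nt_nt _

theorem nt_mul (a b : A) : nt (a * b) = pl (nt a) (nt b) := by simp [pl, nt_nt]

theorem pl_comm (a b : A) : pl a b = pl b a := by simp [pl, mul_comm]

theorem pl_assoc (a b c : A) : pl (pl a b) c = pl a (pl b c) := by
  simp [pl, nt_nt, mul_assoc]

theorem le_nt_symm {a b : A} (h : a ≤ nt b) : b ≤ nt a := by
  have h1 : (1 : A) ≤ nt (a * b) := (le_nt_mul _ _ _).2 (by simpa using h)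
  rw [mul_comm, le_nt_mul] at h1
  simpa using h1

theorem nt_le_nt {a b : A} (h : a ≤ b) : nt b ≤ nt a :=
  le_nt_symm (by rwa [nt_nt])

theorem nt_le_symm {a b : A} (h : nt a ≤ b) : nt b ≤ a := by
  simpa [nt_nt] using nt_le_nt h

theorem nt_one_le (a : A) : nt 1 ≤ a := nt_le_symm (le_one' _)

theorem mul_mono_left {a a' : A} (h : a ≤ a') (b : A) : a * b ≤ a' * b := by
  rw [← nt_nt (a' * b), ← le_nt_mul]
  refine h.trans ?_
  rw [le_nt_mul, nt_nt]

theorem mul_mono {a a' b b' : A} (h : a ≤ a') (h' : b ≤ b') : a * b ≤ a' * b' := by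
  refine (mul_mono_left h b).trans ?_
  rw [mul_comm a' b, mul_comm a' b']
  exact mul_mono_left h' a'

theorem pl_mono {a a' b b' : A} (h : a ≤ a') (h' : b ≤ b') : pl a b ≤ pl a' b' :=
  nt_le_nt (mul_mono (nt_le_nt h) (nt_le_nt h'))

theorem pl_nt_one (a : A) : pl a (nt 1) = a := by simp [pl, nt_nt]

theorem le_pl_left (a b : A) : a ≤ pl a b := by
  simpa [pl_nt_one] using pl_mono (le_refl a) (nt_one_le b)

theorem mul_eq_zero_iff {a b : A} : a * b = nt 1 ↔ a ≤ nt b := by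
  have := le_nt_mul a b 1
  simp only [mul_one] at this
  rw [this]
  exact ⟨fun h => h.le, fun h => le_antisymm h (nt_one_le _)⟩

theorem pl_eq_one_iff {a b : A} : pl a b = 1 ↔ nt a ≤ b := by
  have : pl a b = 1 ↔ nt a * nt b = nt 1 :=
    ⟨fun h => by rw [← nt_pl, h], fun h => by rw [pl, h, nt_nt]⟩
  rw [this, mul_eq_zero_iff, nt_nt]

theorem mul_pl_nt (a d : A) : a * pl (nt a) d = min a d := by
  rw [pl, nt_nt, mul_nt_mul_nt]

theorem nt_min (a b : A) : nt (min a b) = max (nt a) (nt b) := by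
  rcases le_total a b with h | h
  · rw [min_eq_left h, max_eq_left (nt_le_nt h)]
  · rw [min_eq_right h, max_eq_right (nt_le_nt h)]

theorem pl_mul_nt (a b : A) : pl (nt a) (a * b) = max (nt a) b := by
  have := mul_nt_mul_nt a (nt b)
  rw [nt_nt] at this
  rw [pl, nt_nt, this, nt_min, nt_nt]

theorem mul_pl_assoc {a b c : A} (hab : nt a ≤ b) (hbc : c ≤ nt b) :
    pl (a * b) c = a * pl b c := by
  have h1 : pl (nt a) (a * b) = b := by rw [pl_mul_nt, max_eq_right hab]
  have h2 : pl (a * b) c ≤ a := by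
    refine (pl_mono le_rfl hbc).trans ?_
    rw [pl_comm, mul_comm, pl_mul_nt]
    exact max_le (nt_le_symm hab) le_rfl
  conv_rhs => rw [← h1, pl_assoc, mul_pl_nt, min_eq_right h2]

theorem pl_mul_assoc {a b c : A} (hab : a ≤ nt b) (hbc : b ≤ nt c) (h : nt c ≤ pl a b) :
    pl a b * c = a * pl b c := by
  set s := pl a b with hs
  have h1 : c = pl (nt s) (s * c) := by rw [pl_mul_nt, max_eq_right (nt_le_symm h)]
  have h2 : pl b (nt s) = nt a := by
    have := pl_mul_nt (nt b) (nt a)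
    rw [nt_nt, mul_comm] at this
    rw [hs, nt_pl, this]
    exact max_eq_right (le_nt_symm hab)
  have h3 : s * c ≤ a := by
    have := mul_pl_nt (nt b) a
    rw [nt_nt] at this
    calc s * c ≤ s * nt b := mul_mono le_rfl (le_nt_symm hbc)
      _ = nt b * pl b a := by rw [hs, mul_comm, pl_comm]
      _ ≤ a := by rw [this]; exact min_le_right _ _
  conv_rhs => rw [h1, ← pl_assoc, h2, mul_pl_nt, min_eq_right h3]

theorem pl_le_nt {x y z : A} (hyz : y ≤ nt z) (hx : x ≤ nt (pl y z)) : pl x y ≤ nt z := by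
  rw [pl_comm]
  refine (pl_mono le_rfl hx).trans ?_
  have := pl_mul_nt (nt y) (nt z)
  rw [nt_nt, ← nt_pl] at this
  rw [this]
  exact max_le hyz le_rfl

theorem le_nt_of_small {a b : A} (ha : a ≤ nt a) (hb : b ≤ nt b) : a ≤ nt b := by
  rcases le_total a b with h' | h'
  · exact h'.trans hb
  · exact ha.trans (nt_le_nt h')

theorem pl_pl_pl_comm (a b : A) : pl (pl a b) (pl a b) = pl (pl a a) (pl b b) := by
  rw [pl_assoc, pl_assoc, ← pl_assoc b a b, ← pl_assoc a b b, pl_comm b a]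

theorem pl_self_le_nt {a b : A} (ha : a ≤ nt a) (hb : b ≤ nt b)
    (h : pl a b ≤ nt (pl a b)) : pl a a ≤ nt (pl b b) := by
  have h1 : pl (pl a b) a ≤ nt b := pl_le_nt (le_nt_of_small ha hb) h
  rw [pl_comm a b, pl_assoc] at h1
  have h2 := le_nt_symm h1
  have h3 : b ≤ nt (pl a a) :=
    h2.trans (nt_le_nt ((le_pl_left _ b).trans_eq (pl_comm _ _)))
  exact le_nt_symm (pl_le_nt h3 h2)

theorem pl_sq_of_small {a b : A} (ha : a ≤ nt a) (hb : b ≤ nt b)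
    (h : nt (pl a b) ≤ pl a b) : pl a b * pl a b = pl a a * pl b b := by
  have hab : a ≤ nt b := le_nt_of_small ha hb
  have htot : pl (pl a b) (pl a b) = 1 := pl_eq_one_iff.2 h
  have e1 : pl (pl a a) (pl b b) = pl (pl a b) (pl a b) := (pl_pl_pl_comm a b).symm
  rcases le_total a (nt (pl a b)) with h' | h'
  · have e2 : pl b a * pl a b = b * pl a (pl a b) :=
      pl_mul_assoc (le_nt_symm hab) h' (by rwa [pl_comm b a])
    have h'' : pl a a ≤ nt b := pl_le_nt hab h'
    have e3 : pl (pl a a) b * b = pl a a * pl b b := by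
      refine pl_mul_assoc h'' hb ?_
      apply nt_le_symm
      rw [← pl_eq_one_iff, pl_assoc, e1, htot]
    rw [← e3, pl_assoc, mul_comm _ b, ← e2, pl_comm b a]
  · have h'' : nt a ≤ pl a b := nt_le_symm h'
    have e2 : pl (pl a b * a) b = pl a b * pl a b := mul_pl_assoc h' (le_nt_symm hab)
    have e3 : pl b a * a = b * pl a a := by
      refine pl_mul_assoc (le_nt_symm hab) ha ?_
      rwa [pl_comm]
    have e4 : pl (pl a a * b) b = pl a a * pl b b := by
      refine mul_pl_assoc ?_ hb
      rw [← pl_eq_one_iff, pl_assoc]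
      exact pl_eq_one_iff.2 h''
    rw [← e2, ← e4, pl_comm a b, e3, mul_comm]

theorem pl_sq_of_large {a : A} (ha : nt a ≤ a) (b : A) :
    pl a b * pl a b = pl (a * a) (pl b b) := by
  rcases le_total b (nt a) with h | h
  · have e1 : pl (a * a) b = a * pl a b := mul_pl_assoc ha h
    have e2 : pl (pl a b * a) b = pl a b * pl a b :=
      mul_pl_assoc ((nt_le_nt (le_pl_left a b)).trans ha) h
    rw [← e2, ← pl_assoc, e1, mul_comm]
  · have e1 : pl a b = 1 := pl_eq_one_iff.2 h
    have e2 : pl (a * a) (pl b b) = 1 := by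
      rw [pl_eq_one_iff, nt_mul]
      exact pl_mono h h
    rw [e1, e2, mul_one]

/-- Doubling on the circle obtained from the chain by identifying its endpoints. -/
def dbl (a : A) : A := if a ≤ nt a then pl a a else a * a

/-- The first binary digit. -/
noncomputable def dig (a : A) : ℝ := if a ≤ nt a then 0 else 1

/-- The standard part of an element of a linearly ordered MV-algebra, given by its binary
expansion. -/
noncomputable def std (a : A) : ℝ := ∑' i : ℕ, dig (dbl^[i] a) * (1 / 2) ^ (i + 1)

theorem dig_mem (a : A) : 0 ≤ dig a ∧ dig a ≤ 1 := by
  unfold dig; split_ifs <;> norm_num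

theorem hasSum_half : HasSum (fun i : ℕ => (1 / 2 : ℝ) ^ (i + 1)) 1 := by
  have := hasSum_geometric_two.mul_right (1 / 2 : ℝ)
  simpa [pow_succ] using this

theorem summable_std (a : A) :
    Summable fun i : ℕ => dig (dbl^[i] a) * (1 / 2 : ℝ) ^ (i + 1) := by
  refine Summable.of_nonneg_of_le (fun i => ?_) (fun i => ?_) hasSum_half.summable
  · exact mul_nonneg (dig_mem _).1 (by positivity)
  · exact mul_le_of_le_one_left (by positivity) (dig_mem _).2

theorem std_nonneg (a : A) : 0 ≤ std a :=
  tsum_nonneg fun _ => mul_nonneg (dig_mem _).1 (by positivity)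

theorem std_le_one (a : A) : std a ≤ 1 := by
  rw [← hasSum_half.tsum_eq]
  exact (summable_std a).tsum_le_tsum
    (fun i => mul_le_of_le_one_left (by positivity) (dig_mem _).2) hasSum_half.summable

theorem std_eq (a : A) : std a = (dig a + std (dbl a)) / 2 := by
  rw [std, (summable_std a).tsum_eq_zero_add, std]
  simp only [Function.iterate_zero, id, Function.iterate_succ, Function.comp]
  rw [add_div, div_eq_mul_inv (∑' _, _), ← tsum_mul_right]
  congr 1
  · ring
  · congr 1; ext i; ring

theorem std_of_le {a : A} (h : a ≤ nt a) : std a = std (pl a a) / 2 := by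
  rw [std_eq]; simp [dig, dbl, h]

theorem std_of_not_le {a : A} (h : ¬ a ≤ nt a) : std a = (1 + std (a * a)) / 2 := by
  rw [std_eq]; simp [dig, dbl, h]

theorem eq_of_forall_abs_le {x y : ℝ} (h : ∀ n : ℕ, |x - y| ≤ (1 / 2) ^ n) : x = y := by
  have := ge_of_tendsto' (tendsto_pow_atTop_nhds_zero_of_lt_one (by norm_num : (0 : ℝ) ≤ 1 / 2)
    (by norm_num)) h
  exact sub_eq_zero.1 (abs_nonpos_iff.1 this)

theorem std_mono {a b : A} (h : a ≤ b) : std a ≤ std b := by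
  suffices H : ∀ n : ℕ, std a ≤ std b + (1 / 2) ^ n by
    have h1 := tendsto_pow_atTop_nhds_zero_of_lt_one (by norm_num : (0 : ℝ) ≤ 1 / 2) (by norm_num)
    have := ge_of_tendsto' (h1.const_add (std b)) H
    simpa using this
  intro n
  induction n generalizing a b with
  | zero => simpa using (std_le_one a).trans (by linarith [std_nonneg b])
  | succ n ih =>
    rw [pow_succ]
    by_cases ha : a ≤ nt a <;> by_cases hb : b ≤ nt b
    · have := ih (pl_mono h h)
      rw [std_of_le ha, std_of_le hb]; linarith
    · have : (0 : ℝ) < (1 / 2) ^ n := by positivity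
      have := std_le_one (pl a a)
      have := std_nonneg (b * b)
      rw [std_of_le ha, std_of_not_le hb]; linarith
    · exact absurd (h.trans (hb.trans (nt_le_nt h))) ha
    · have := ih (mul_mono h h)
      rw [std_of_not_le ha, std_of_not_le hb]; linarith

theorem std_one (h : (nt 1 : A) ≠ 1) : std (1 : A) = 1 := by
  have h' : ¬ (1 : A) ≤ nt 1 := fun h1 => h (le_antisymm (le_one' _) h1)
  have := std_of_not_le h'
  rw [mul_one] at this
  linarith

theorem std_zero : std (nt 1 : A) = 0 := by
  have := std_of_le (nt_one_le (nt (nt 1 : A)))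
  rw [pl_nt_one] at this
  linarith

theorem std_nt (h0 : (nt 1 : A) ≠ 1) (a : A) : std (nt a) = 1 - std a := by
  refine eq_of_forall_abs_le fun n => ?_
  induction n generalizing a with
  | zero =>
    have := std_nonneg a; have := std_le_one a
    have := std_nonneg (nt a); have := std_le_one (nt a)
    rw [abs_le]; constructor <;> norm_num <;> linarith
  | succ n ih =>
    have key : ∀ b : A, b ≤ nt b → |std (nt b) - (1 - std b)| ≤ (1 / 2) ^ (n + 1) := by
      intro b hb
      by_cases hb' : nt b ≤ b
      · have e : nt b = b := le_antisymm hb' hb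
        have e1 : pl b b = 1 := pl_eq_one_iff.2 hb'
        have := std_of_le hb
        rw [e1, std_one h0] at this
        rw [e, this]; norm_num
      · have h1 := std_of_le hb
        have h2 := std_of_not_le (a := nt b) (by rwa [nt_nt])
        have h3 := ih (pl b b)
        rw [nt_pl] at h3
        rw [abs_le] at h3 ⊢
        rw [h1, h2, pow_succ]
        constructor <;> linarith
    rcases le_total a (nt a) with h | h
    · exact key a h
    · have := key (nt a) (by rwa [nt_nt])
      rw [nt_nt] at this
      rw [abs_le] at this ⊢
      constructor <;> linarith

theorem std_pl (h0 : (nt 1 : A) ≠ 1) (a b : A) : std (pl a b) = min 1 (std a + std b) := by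
  have h1 : std (1 : A) = 1 := std_one h0
  refine eq_of_forall_abs_le fun n => ?_
  induction n generalizing a b with
  | zero =>
    have := std_nonneg a; have := std_nonneg b
    have := std_nonneg (pl a b); have := std_le_one (pl a b)
    rw [abs_le]
    rcases min_cases 1 (std a + std b) with h | h <;> rw [h.1] <;>
      constructor <;> norm_num <;> linarith
  | succ n ih =>
    have hn : (0 : ℝ) < (1 / 2) ^ n := by positivity
    have hmul : ∀ x y : A, |std (x * y) - max 0 (std x + std y - 1)| ≤ (1 / 2) ^ n := by
      intro x y
      have h := ih (nt x) (nt y)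
      rw [← nt_mul, std_nt h0, std_nt h0, std_nt h0] at h
      rw [abs_le] at h ⊢
      rcases min_cases 1 (1 - std x + (1 - std y)) with h2 | h2 <;> rw [h2.1] at h <;>
        rcases max_cases 0 (std x + std y - 1) with h3 | h3 <;> rw [h3.1] <;>
        constructor <;> linarith [h.1, h.2]
    have large_small : ∀ x y : A, ¬ x ≤ nt x → y ≤ nt y →
        |std (pl x y) - min 1 (std x + std y)| ≤ (1 / 2) ^ (n + 1) := by
      intro x y hx hy
      have hx' : nt x ≤ x := (le_total _ _).resolve_left hx
      have hs : ¬ pl x y ≤ nt (pl x y) := fun h =>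
        hx ((le_pl_left x y).trans (h.trans (nt_le_nt (le_pl_left x y))))
      have e := std_of_not_le hs
      rw [pl_sq_of_large hx' y] at e
      have h := ih (x * x) (pl y y)
      rw [e, std_of_not_le hx, std_of_le hy, pow_succ]
      rw [abs_le] at h ⊢
      rcases min_cases 1 (std (x * x) + std (pl y y)) with h2 | h2 <;> rw [h2.1] at h <;>
        rcases min_cases 1 ((1 + std (x * x)) / 2 + std (pl y y) / 2) with h3 | h3 <;>
        rw [h3.1] <;> constructor <;> linarith [h.1, h.2]
    by_cases ha : a ≤ nt a <;> by_cases hb : b ≤ nt b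
    · by_cases hs : pl a b ≤ nt (pl a b)
      · have e := pl_pl_pl_comm a b
        have h4 := std_mono (pl_self_le_nt ha hb hs)
        rw [std_nt h0] at h4
        have h := ih (pl a a) (pl b b)
        rw [std_of_le hs, e, std_of_le ha, std_of_le hb, pow_succ]
        have := std_le_one (pl a a); have := std_le_one (pl b b)
        rw [min_eq_right (by linarith)] at h ⊢
        rw [abs_le] at h ⊢
        constructor <;> linarith [h.1, h.2]
      · have hs' : nt (pl a b) ≤ pl a b := (le_total _ _).resolve_left hs
        have h := hmul (pl a a) (pl b b)
        rw [std_of_not_le hs, pl_sq_of_small ha hb hs', std_of_le ha, std_of_le hb, pow_succ]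
        have := std_le_one (pl a a); have := std_le_one (pl b b)
        have h4 : pl (pl a a) (pl b b) = 1 := by
          rw [← pl_pl_pl_comm]; exact pl_eq_one_iff.2 hs'
        have h5 := std_mono (pl_eq_one_iff.1 h4)
        rw [std_nt h0] at h5
        rw [min_eq_right (by linarith)]
        rw [max_eq_right (by linarith)] at h
        rw [abs_le] at h ⊢
        constructor <;> linarith [h.1, h.2]
    · rw [pl_comm, add_comm]
      exact large_small b a hb ha
    · exact large_small a b ha hb
    · have e : pl a b = 1 := by
        have ha' : nt a ≤ a := (le_total _ _).resolve_left ha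
        have hb' : nt b ≤ b := (le_total _ _).resolve_left hb
        rw [pl_eq_one_iff]
        rcases le_total a b with h | h
        · exact ha'.trans h
        · exact (nt_le_nt h).trans hb'
      have h2 := std_of_not_le ha
      have h3 := std_of_not_le hb
      have := std_nonneg (a * a); have := std_nonneg (b * b)
      rw [e, h1, min_eq_left (by linarith)]
      simp

theorem std_mul (h0 : (nt 1 : A) ≠ 1) (a b : A) :
    std (a * b) = max 0 (std a + std b - 1) := by
  have h := std_pl h0 (nt a) (nt b)
  rw [← nt_mul, std_nt h0, std_nt h0, std_nt h0] at h
  rcases min_cases 1 (1 - std a + (1 - std b)) with h2 | h2 <;>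
    rcases max_cases 0 (std a + std b - 1) with h3 | h3 <;> linarith

end MVChain

variable {V : Type*}

local infixr:55 " ⟹ " => Fm.imp
local infixl:65 " ⊛ " => Fm.mul
local infixr:60 " ⋎ " => Fm.or
local prefix:max "◻" => Fm.box
local prefix:max "◇" => Fm.dia

/-- Sets of formulas that contain the axioms of Łukasiewicz logic and are closed under Modus
Ponens. -/
structure IsTheory (T : Set (Fm V)) : Prop where
  ax {φ : Fm V} : LukAx φ → φ ∈ T
  mp {φ ψ : Fm V} : (φ ⟹ ψ) ∈ T → φ ∈ T → ψ ∈ T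

namespace IsTheory

variable {T : Set (Fm V)} (hT : IsTheory T) {a b c d : Fm V}

include hT

theorem trans (h : (a ⟹ b) ∈ T) (h' : (b ⟹ c) ∈ T) : (a ⟹ c) ∈ T :=
  hT.mp (hT.mp (hT.ax (.a1 a b c)) h) h'

theorem mul_imp_iff : (a ⊛ b ⟹ c) ∈ T ↔ (a ⟹ b ⟹ c) ∈ T :=
  ⟨hT.mp (hT.ax (.a5b a b c)), hT.mp (hT.ax (.a5a a b c))⟩

theorem mul_left : (a ⊛ b ⟹ a) ∈ T := hT.ax (.a2 a b)

theorem mul_comm : (a ⊛ b ⟹ b ⊛ a) ∈ T := hT.ax (.a3 a b)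

theorem mul_right : (a ⊛ b ⟹ b) ∈ T := hT.trans hT.mul_comm hT.mul_left

theorem weaken (h : a ∈ T) : (b ⟹ a) ∈ T := hT.mp (hT.mul_imp_iff.1 hT.mul_left) h

theorem refl : (a ⟹ a) ∈ T :=
  hT.mp (hT.mul_imp_iff.1 hT.mul_right) (hT.ax (.a7 a))

theorem bot_imp : (Fm.bot ⟹ a) ∈ T := hT.ax (.a7 a)

theorem mul_mono_left (h : (a ⟹ b) ∈ T) : (a ⊛ c ⟹ b ⊛ c) ∈ T :=
  hT.mul_imp_iff.2 (hT.trans h (hT.mul_imp_iff.1 hT.refl))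

theorem mul_mono (h : (a ⟹ b) ∈ T) (h' : (c ⟹ d) ∈ T) : (a ⊛ c ⟹ b ⊛ d) ∈ T :=
  hT.trans (hT.mul_mono_left h)
    (hT.trans hT.mul_comm (hT.trans (hT.mul_mono_left h') hT.mul_comm))

theorem swap (h : (a ⟹ b ⟹ c) ∈ T) : (b ⟹ a ⟹ c) ∈ T :=
  hT.mul_imp_iff.1 (hT.trans hT.mul_comm (hT.mul_imp_iff.2 h))

theorem imp_mono_right (h : (b ⟹ c) ∈ T) : ((a ⟹ b) ⟹ (a ⟹ c)) ∈ T :=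
  hT.mp (hT.swap (hT.ax (.a1 a b c))) h

theorem imp_mono_left (h : (a ⟹ b) ∈ T) : ((b ⟹ c) ⟹ (a ⟹ c)) ∈ T :=
  hT.mp (hT.ax (.a1 a b c)) h

theorem app : (a ⟹ (a ⟹ b) ⟹ b) ∈ T := hT.swap hT.refl

theorem swap_imp : ((a ⟹ b ⟹ c) ⟹ (b ⟹ a ⟹ c)) ∈ T :=
  hT.trans (hT.ax (.a5a a b c))
    (hT.trans (hT.imp_mono_left hT.mul_comm) (hT.ax (.a5b b a c)))

theorem mul_assoc_iff : ((a ⊛ b) ⊛ c ⟹ d) ∈ T ↔ (a ⊛ (b ⊛ c) ⟹ d) ∈ T := by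
  rw [hT.mul_imp_iff, hT.mul_imp_iff, hT.mul_imp_iff]
  exact ⟨fun h => hT.trans h (hT.ax (.a5a _ _ _)), fun h => hT.trans h (hT.ax (.a5b _ _ _))⟩

theorem dne : (a.neg.neg ⟹ a) ∈ T := hT.ax (.dne a)

theorem dni : (a ⟹ a.neg.neg) ∈ T := hT.app

theorem neg_mono (h : (a ⟹ b) ∈ T) : (b.neg ⟹ a.neg) ∈ T := hT.imp_mono_left h

theorem top_mem : (Fm.top : Fm V) ∈ T := hT.bot_imp

theorem le_neg_mul_iff : (a ⟹ (b ⊛ c).neg) ∈ T ↔ (a ⊛ b ⟹ c.neg) ∈ T := by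
  rw [Fm.neg, ← hT.mul_imp_iff, ← hT.mul_assoc_iff, hT.mul_imp_iff, Fm.neg]

theorem imp_iff_neg : ((a ⟹ b) ⟹ (a ⊛ b.neg).neg) ∈ T ∧ ((a ⊛ b.neg).neg ⟹ a ⟹ b) ∈ T := by
  constructor
  · rw [hT.le_neg_mul_iff]
    exact hT.trans (hT.mul_imp_iff.2 hT.refl) hT.dni
  · rw [← hT.mul_imp_iff]
    exact hT.trans (hT.le_neg_mul_iff.1 hT.refl) hT.dne

/-- `c` follows from a disjunction whenever it follows from both disjuncts. -/
theorem or_imp (ha : (a ⟹ c) ∈ T) (hb : (b ⟹ c) ∈ T) : (a ⋎ b ⟹ c) ∈ T := by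
  refine hT.mp (hT.mp (hT.ax (.a6 a b (a ⋎ b ⟹ c))) ?_) ?_
  · rw [← hT.mul_imp_iff]
    refine hT.trans (hT.mul_mono hT.refl hT.mul_left) ?_
    exact hT.trans (hT.mul_imp_iff.2 hT.app) hb
  · rw [← hT.mul_imp_iff]
    refine hT.trans (hT.mul_mono hT.refl (hT.trans (hT.ax (.a4 _ _)) hT.mul_left)) ?_
    exact hT.trans (hT.mul_imp_iff.2 hT.app) ha

theorem imp_and (ha : (c ⟹ a) ∈ T) (hb : (c ⟹ b) ∈ T) : (c ⟹ a.and b) ∈ T := by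
  refine hT.trans (b := c ⊛ (c ⟹ a)) ?_ (hT.trans (hT.ax (.a4 _ _)) ?_)
  · exact hT.trans (b := (c ⟹ a) ⊛ c) (hT.mp (hT.mul_imp_iff.1 hT.refl) ha) hT.mul_comm
  · exact hT.mul_mono hT.refl (hT.imp_mono_right hb)

theorem and_right : (a.and b ⟹ b) ∈ T := hT.trans (hT.ax (.a4 a b)) hT.mul_left

theorem imp_or_right : (b ⟹ a ⋎ b) ∈ T :=
  hT.imp_and (hT.mul_imp_iff.1 hT.mul_left) hT.app

theorem iterate_imp_mono (n : ℕ) (h : (b ⟹ c) ∈ T) :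
    ((a.imp)^[n] b ⟹ (a.imp)^[n] c) ∈ T := by
  induction n with
  | zero => exact h
  | succ n ih => rw [Function.iterate_succ_apply', Function.iterate_succ_apply']
                 exact hT.imp_mono_right ih

theorem iterate_imp_swap (n : ℕ) :
    ((a.imp)^[n] (b ⟹ c) ⟹ b ⟹ (a.imp)^[n] c) ∈ T := by
  induction n with
  | zero => exact hT.refl
  | succ n ih =>
    rw [Function.iterate_succ_apply', Function.iterate_succ_apply']
    exact hT.trans (hT.imp_mono_right ih) hT.swap_imp

/-- The theory generated by `T` and `a`. -/
theorem adjoin (a : Fm V) : IsTheory {b | ∃ n, (a.imp)^[n] b ∈ T} where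
  ax h := ⟨0, hT.ax h⟩
  mp := by
    rintro b c ⟨n, hn⟩ ⟨m, hm⟩
    refine ⟨n + m, ?_⟩
    have h1 := hT.mp (hT.iterate_imp_mono (a := a) m (hT.app (a := b) (b := c))) hm
    have h2 := hT.mp (hT.iterate_imp_swap m) h1
    rw [Function.iterate_add_apply]
    exact hT.mp (hT.iterate_imp_mono n h2) hn

theorem prelinear {n m : ℕ} (hn : ((a ⟹ b).imp)^[n] c ∈ T)
    (hm : ((b ⟹ a).imp)^[m] c ∈ T) : c ∈ T := by
  have one : ∀ (m : ℕ) (c : Fm V), ((a ⟹ b) ⟹ c) ∈ T → ((b ⟹ a).imp)^[m] c ∈ T → c ∈ T := by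
    intro m
    induction m with
    | zero => intro c _ h; exact h
    | succ m ih =>
      intro c hc h
      rw [Function.iterate_succ_apply'] at h
      refine ih c hc (hT.mp (hT.mp (hT.ax (.a6 a b _)) ?_) h)
      refine hT.trans hc ?_
      clear ih h
      induction m with
      | zero => exact hT.refl
      | succ m ih => rw [Function.iterate_succ_apply']
                     exact hT.trans ih (hT.mul_imp_iff.1 hT.mul_left)
  induction n generalizing c with
  | zero => exact hn
  | succ n ih =>
    rw [Function.iterate_succ_apply] at hn
    refine one m c (ih hn ?_) hm
    exact hT.mp (hT.iterate_imp_mono m (hT.mul_imp_iff.1 hT.mul_left)) hm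

/-- Prime extension. -/
theorem exists_prime (hd : d ∉ T) : ∃ P, IsTheory P ∧ T ⊆ P ∧ d ∉ P ∧
    ∀ a b : Fm V, (a ⟹ b) ∈ P ∨ (b ⟹ a) ∈ P := by
  obtain ⟨P, hTP, ⟨hP, hdP⟩, hmax⟩ := zorn_subset_nonempty
    {P : Set (Fm V) | IsTheory P ∧ d ∉ P} (by
      intro C hC hchain hne
      refine ⟨⋃₀ C, ⟨⟨?_, ?_⟩, ?_⟩, fun s hs => Set.subset_sUnion_of_mem hs⟩
      · intro φ h
        obtain ⟨s, hs⟩ := hne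
        exact ⟨s, hs, (hC hs).1.ax h⟩
      · rintro φ ψ ⟨s, hs, h⟩ ⟨t, ht, h'⟩
        rcases hchain.total hs ht with hst | hst
        · exact ⟨t, ht, (hC ht).1.mp (hst h) h'⟩
        · exact ⟨s, hs, (hC hs).1.mp h (hst h')⟩
      · rintro ⟨s, hs, h⟩
        exact (hC hs).2 h) T ⟨hT, hd⟩
  refine ⟨P, hP, hTP, hdP, fun a b => ?_⟩
  have key : ∀ x : Fm V, x ∉ P → ∃ n, (x.imp)^[n] d ∈ P := by
    intro x hx
    by_contra hcon
    have := hmax (y := {b | ∃ n, (x.imp)^[n] b ∈ P}) ⟨hP.adjoin x, hcon⟩ (fun y hy => ⟨0, hy⟩)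
    exact hx (this ⟨1, hP.refl⟩)
  by_contra! hcon
  obtain ⟨n, hn⟩ := key _ hcon.1
  obtain ⟨m, hm⟩ := key _ hcon.2
  exact hdP (hP.prelinear hn hm)

end IsTheory

/-- Homomorphisms, for the propositional connectives, from formulas to the standard MV-algebra. -/
structure IsHom (g : Fm V → ℝ) : Prop where
  nonneg (a : Fm V) : 0 ≤ g a
  le_one (a : Fm V) : g a ≤ 1
  bot : g Fm.bot = 0
  mul (a b : Fm V) : g (a ⊛ b) = max 0 (g a + g b - 1)
  imp (a b : Fm V) : g (a ⟹ b) = min 1 (1 - g a + g b)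

section Quotient

/-- Interderivability in a theory. -/
def thSetoid {T : Set (Fm V)} (hT : IsTheory T) : Setoid (Fm V) where
  r a b := (a ⟹ b) ∈ T ∧ (b ⟹ a) ∈ T
  iseqv := ⟨fun _ => ⟨hT.refl, hT.refl⟩, fun h => ⟨h.2, h.1⟩,
    fun h h' => ⟨hT.trans h.1 h'.1, hT.trans h'.2 h.2⟩⟩

/-- The Lindenbaum algebra of a prime theory. -/
@[reducible] noncomputable def primeChain {P : Set (Fm V)} (hP : IsTheory P)
    (hlin : ∀ a b : Fm V, (a ⟹ b) ∈ P ∨ (b ⟹ a) ∈ P) : MVChain (Quotient (thSetoid hP)) :=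
  letI : LinearOrder (Quotient (thSetoid hP)) :=
    { le := Quotient.lift₂ (fun a b => (a ⟹ b) ∈ P) fun _ _ _ _ h h' => propext
        ⟨fun k => hP.trans h.2 (hP.trans k h'.1), fun k => hP.trans h.1 (hP.trans k h'.2)⟩
      le_refl := by rintro ⟨a⟩; exact hP.refl
      le_trans := by rintro ⟨a⟩ ⟨b⟩ ⟨c⟩; exact hP.trans
      le_antisymm := by rintro ⟨a⟩ ⟨b⟩ h h'; exact Quotient.sound ⟨h, h'⟩
      le_total := by rintro ⟨a⟩ ⟨b⟩; exact hlin a b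
      toDecidableLE := Classical.decRel _ }
  { mul := Quotient.map₂ Fm.mul fun _ _ h _ _ h' =>
      ⟨hP.mul_mono h.1 h'.1, hP.mul_mono h.2 h'.2⟩
    one := Quotient.mk _ Fm.top
    mul_assoc := by
      rintro ⟨a⟩ ⟨b⟩ ⟨c⟩
      exact Quotient.sound ⟨hP.mul_assoc_iff.2 hP.refl, hP.mul_assoc_iff.1 hP.refl⟩
    mul_comm := by rintro ⟨a⟩ ⟨b⟩; exact Quotient.sound ⟨hP.mul_comm, hP.mul_comm⟩
    one_mul := by
      rintro ⟨a⟩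
      exact Quotient.sound ⟨hP.mul_right, hP.mp (hP.mul_imp_iff.1 hP.refl) hP.top_mem⟩
    mul_one := by
      rintro ⟨a⟩
      exact Quotient.sound ⟨hP.mul_left,
        hP.trans (hP.mp (hP.mul_imp_iff.1 hP.refl) hP.top_mem) hP.mul_comm⟩
    nt := Quotient.map Fm.neg fun _ _ h => ⟨hP.neg_mono h.2, hP.neg_mono h.1⟩
    nt_nt := by rintro ⟨a⟩; exact Quotient.sound ⟨hP.dne, hP.dni⟩
    le_one' := by rintro ⟨a⟩; exact hP.weaken hP.top_mem
    le_nt_mul := by rintro ⟨a⟩ ⟨b⟩ ⟨c⟩; exact hP.le_neg_mul_iff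
    mul_nt_mul_nt := by
      rintro ⟨a⟩ ⟨b⟩
      refine le_antisymm (le_min ?_ ?_) ?_
      · exact hP.mul_left
      · exact hP.trans (hP.mul_mono hP.refl hP.imp_iff_neg.2) hP.and_right
      · rcases le_total (Quotient.mk (thSetoid hP) a) (Quotient.mk (thSetoid hP) b) with h | h
        · exact (min_le_left _ _).trans (hP.trans (hP.imp_and hP.refl h)
            (hP.mul_mono hP.refl hP.imp_iff_neg.1))
        · exact (min_le_right _ _).trans (hP.trans (hP.imp_and h hP.refl)
            (hP.mul_mono hP.refl hP.imp_iff_neg.1)) }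

end Quotient

/-- A consistent prime theory has a homomorphism to the standard MV-algebra. -/
theorem IsTheory.exists_hom {P : Set (Fm V)} (hP : IsTheory P)
    (hlin : ∀ a b : Fm V, (a ⟹ b) ∈ P ∨ (b ⟹ a) ∈ P) (hbot : Fm.bot ∉ P) :
    ∃ g : Fm V → ℝ, IsHom g ∧ ∀ a b, (a ⟹ b) ∈ P → g a ≤ g b := by
  let _ := primeChain hP hlin
  have h0 : (MVChain.nt 1 : Quotient (thSetoid hP)) ≠ 1 := by
    intro h
    have h1 : (1 : Quotient (thSetoid hP)) ≤ MVChain.nt 1 := h.ge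
    have h2 : (Fm.top ⟹ Fm.top.neg) ∈ P := h1
    exact hbot (hP.mp (hP.mp h2 hP.top_mem) hP.top_mem)
  let q : Fm V → Quotient (thSetoid hP) := Quotient.mk _
  have hbotq : q Fm.bot = MVChain.nt 1 :=
    Quotient.sound ⟨hP.bot_imp, hP.app |> fun h => hP.mp h hP.top_mem⟩
  have hmul : ∀ a b, q (a ⊛ b) = q a * q b := fun a b => rfl
  have himp : ∀ a b, q (a ⟹ b) = MVChain.nt (q a * MVChain.nt (q b)) := fun a b =>
    Quotient.sound hP.imp_iff_neg
  refine ⟨fun a => MVChain.std (q a), ⟨fun a => MVChain.std_nonneg _, fun a =>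
    MVChain.std_le_one _, ?_, fun a b => ?_, fun a b => ?_⟩, fun a b h => MVChain.std_mono h⟩
  · simp only [hbotq, MVChain.std_zero]
  · simp only [hmul, MVChain.std_mul h0]
  · simp only [himp, MVChain.std_mul h0, MVChain.std_nt h0]
    rcases max_cases 0 (MVChain.std (q a) + (1 - MVChain.std (q b)) - 1) with h | h <;>
      rcases min_cases 1 (1 - MVChain.std (q a) + MVChain.std (q b)) with h' | h' <;> linarith

namespace IsHom

variable {g : Fm V → ℝ} (hg : IsHom g)

include hg

theorem imp_eq_one {a b : Fm V} : g (a ⟹ b) = 1 ↔ g a ≤ g b := by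
  rw [hg.imp, min_eq_left_iff]
  constructor <;> intro h <;> linarith

theorem neg (a : Fm V) : g a.neg = 1 - g a := by
  rw [Fm.neg, hg.imp, hg.bot, min_eq_right (by linarith [hg.nonneg a])]
  ring

theorem top : g Fm.top = 1 := hg.imp_eq_one.2 le_rfl

theorem and (a b : Fm V) : g (a.and b) = min (g a) (g b) := by
  rw [Fm.and, hg.mul, hg.imp]
  have := hg.nonneg a; have := hg.nonneg b; have := hg.le_one a
  rcases min_cases 1 (1 - g a + g b) with h | h <;>
    rcases min_cases (g a) (g b) with h' | h' <;> rw [h.1, h'.1]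
  · rw [max_eq_right] <;> linarith
  · rw [max_eq_right] <;> linarith
  · rw [max_eq_right] <;> linarith
  · rw [max_eq_right] <;> linarith

theorem or (a b : Fm V) : g (a ⋎ b) = max (g a) (g b) := by
  rw [Fm.or, hg.and]
  simp only [hg.imp]
  have := hg.le_one b; have := hg.le_one a
  rcases le_total (g a) (g b) with h | h
  · rw [max_eq_right h, min_eq_left (a := (1 : ℝ)) (b := 1 - g a + g b) (by linarith),
      min_eq_right (a := (1 : ℝ)) (b := 1 - g b + g a) (by linarith), min_eq_left]
    · rw [min_eq_right] <;> linarith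
    · refine le_min ?_ ?_
      · exact min_le_left _ _
      · exact (min_le_right _ _).trans (by linarith)
  · rw [max_eq_left h, min_eq_left (a := (1 : ℝ)) (b := 1 - g b + g a) (by linarith),
      min_eq_right (a := (1 : ℝ)) (b := 1 - g a + g b) (by linarith), min_eq_right]
    · rw [min_eq_right] <;> linarith
    · refine le_min ?_ ?_
      · exact min_le_left _ _
      · exact (min_le_right _ _).trans (by linarith)

theorem equ_eq_one {a b : Fm V} : g (a.equ b) = 1 ↔ g a = g b := by
  rw [Fm.equ, hg.and]
  have h1 := hg.le_one (a ⟹ b)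
  have h2 := hg.le_one (b ⟹ a)
  constructor
  · intro h
    exact le_antisymm (hg.imp_eq_one.1 (le_antisymm h1 (h ▸ min_le_left _ _)))
      (hg.imp_eq_one.1 (le_antisymm h2 (h ▸ min_le_right _ _)))
  · intro h
    rw [hg.imp_eq_one.2 h.le, hg.imp_eq_one.2 h.ge, min_self]

theorem luk {a : Fm V} (h : LukAx a) : g a = 1 := by
  cases h with
  | a1 a b c =>
    have := hg.nonneg a; have := hg.nonneg b; have := hg.nonneg c
    have := hg.le_one a; have := hg.le_one b; have := hg.le_one c
    rw [hg.imp_eq_one]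
    simp only [hg.imp, min_def]
    split_ifs <;> linarith
  | a2 a b =>
    rw [hg.imp_eq_one, hg.mul]
    exact max_le (hg.nonneg a) (by linarith [hg.le_one b])
  | a3 a b => rw [hg.imp_eq_one, hg.mul, hg.mul, add_comm (g a)]
  | a4 a b =>
    rw [hg.imp_eq_one]
    have := (hg.and a b).trans ((min_comm _ _).trans (hg.and b a).symm)
    exact this.le
  | a5a a b c =>
    have := hg.nonneg a; have := hg.nonneg b; have := hg.nonneg c
    have := hg.le_one a; have := hg.le_one b; have := hg.le_one c
    rw [hg.imp_eq_one]
    simp only [hg.imp, hg.mul, min_def, max_def]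
    split_ifs <;> linarith
  | a5b a b c =>
    have := hg.nonneg a; have := hg.nonneg b; have := hg.nonneg c
    have := hg.le_one a; have := hg.le_one b; have := hg.le_one c
    rw [hg.imp_eq_one]
    simp only [hg.imp, hg.mul, min_def, max_def]
    split_ifs <;> linarith
  | a6 a b c =>
    have := hg.le_one c
    rw [hg.imp_eq_one]
    rcases le_total (g a) (g b) with h | h
    · rw [hg.imp (a ⟹ b), hg.imp_eq_one.2 h]
      refine (min_le_right _ _).trans ?_
      rw [hg.imp (_ ⟹ _) c]
      exact le_min (by linarith) (by linarith [hg.le_one ((b ⟹ a) ⟹ c)])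
    · have h1 : g ((b ⟹ a) ⟹ c) ≤ g c := by
        rw [hg.imp (b ⟹ a) c, hg.imp_eq_one.2 h]
        exact (min_le_right _ _).trans (by linarith)
      exact (hg.le_one _).trans (hg.imp_eq_one.2 h1).ge
  | a7 a => rw [hg.imp_eq_one, hg.bot]; exact hg.nonneg a
  | dne a => rw [hg.imp_eq_one, hg.neg, hg.neg]; linarith

theorem pow_eq_one {a : Fm V} (h : g a = 1) (n : ℕ) : g (a.pow n) = 1 := by
  induction n using Nat.twoStepInduction with
  | zero => exact hg.top
  | one => exact h
  | more n _ ih => rw [Fm.pow, hg.mul, ih, h]; norm_num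

/-- The powers of an element below `1` become arbitrarily small. -/
theorem pow_le (a : Fm V) (n : ℕ) : g (a.pow n) ≤ max 0 (1 - n * (1 - g a)) := by
  induction n using Nat.twoStepInduction with
  | zero => simp [hg.le_one]
  | one => simp [Fm.pow]
  | more n _ ih =>
    rw [Fm.pow, hg.mul]
    push_cast at ih ⊢
    have := hg.le_one a
    refine max_le (le_max_left _ _) ?_
    rcases max_cases 0 (1 - ((n : ℝ) + 1) * (1 - g a)) with h | h
    · exact le_max_of_le_left (by linarith)
    · exact le_max_of_le_right (by linarith)

theorem le_bigOr {l : List (Fm V)} {a : Fm V} (h : a ∈ l) : g a ≤ g (Fm.bigOr l) := by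
  induction l using Fm.bigOr.induct with
  | case1 => simp at h
  | case2 b => simp at h; simp [h, Fm.bigOr]
  | case3 b c l ih =>
    rw [Fm.bigOr, hg.or]
    rcases List.mem_cons.1 h with rfl | h
    · exact le_max_left _ _
    · exact (ih h).trans (le_max_right _ _)

theorem bigOr_lt_one {l : List (Fm V)} (h : ∀ a ∈ l, g a < 1) : g (Fm.bigOr l) < 1 := by
  induction l using Fm.bigOr.induct with
  | case1 => simp [Fm.bigOr, hg.bot]
  | case2 b => exact h b (by simp)
  | case3 b c l ih =>
    rw [Fm.bigOr, hg.or]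
    exact max_lt (h b (by simp)) (ih fun a ha => h a (List.mem_cons_of_mem _ ha))

theorem bigAnd_le {l : List (Fm V)} {a : Fm V} (h : a ∈ l) : g (Fm.bigAnd l) ≤ g a := by
  induction l using Fm.bigAnd.induct with
  | case1 => simp at h
  | case2 b => simp at h; simp [h, Fm.bigAnd]
  | case3 b c l ih =>
    rw [Fm.bigAnd, hg.and]
    rcases List.mem_cons.1 h with rfl | h
    · exact min_le_left _ _
    · exact (min_le_right _ _).trans (ih h)

theorem bigAnd_eq_one {l : List (Fm V)} (h : ∀ a ∈ l, g a = 1) : g (Fm.bigAnd l) = 1 := by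
  induction l using Fm.bigAnd.induct with
  | case1 => exact hg.top
  | case2 b => exact h b (by simp)
  | case3 b c l ih =>
    rw [Fm.bigAnd, hg.and, h b (by simp), ih fun a ha => h a (List.mem_cons_of_mem _ ha),
      min_self]

end IsHom

/-! Soundness -/

namespace Struc

variable (K : Struc.{u} V)

theorem isHom (x : K.X) : IsHom fun φ => (K.val φ x : ℝ) where
  nonneg _ := unitInterval.nonneg _
  le_one _ := unitInterval.le_one _
  bot := rfl
  mul _ _ := max_comm _ _
  imp _ _ := min_comm _ _

theorem exists_val_box [Finite K.X] (a : Fm V) :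
    ∃ x, (∀ y, K.val (◻a) y = K.val a x) ∧ ∀ y, K.val a x ≤ K.val a y := by
  have := K.nonempty
  obtain ⟨x, hx⟩ := Finite.exists_min (K.val a)
  exact ⟨x, fun y => le_antisymm (iInf_le _ x) (le_iInf hx), hx⟩

theorem exists_val_dia [Finite K.X] (a : Fm V) :
    ∃ x, (∀ y, K.val (◇a) y = K.val a x) ∧ ∀ y, K.val a y ≤ K.val a x := by
  have := K.nonempty
  obtain ⟨x, hx⟩ := Finite.exists_max (K.val a)
  exact ⟨x, fun y => le_antisymm (iSup_le hx) (le_iSup (K.val a) x), hx⟩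

theorem val_modal {ν : Fm V} (h : IsModalComb ν) (x y : K.X) : K.val ν x = K.val ν y := by
  induction h with
  | box | dia | bot => rfl
  | mul _ _ ih ih' => simp [val, ih, ih']
  | imp _ _ ih ih' => simp [val, ih, ih']

theorem val_ax [Finite K.X] {k : ℕ} (hk : Cardinal.mk K.X ≤ (k : Cardinal.{u})) {φ : Fm V}
    (h : S5kAx k φ) (x : K.X) : (K.val φ x : ℝ) = 1 := by
  have hx := K.isHom x
  cases h with
  | s5 h =>
    cases h with
    | luk h => exact hx.luk h
    | boxElim a =>
      obtain ⟨y, hy, hy'⟩ := K.exists_val_box a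
      refine hx.imp_eq_one.2 ?_
      rw [hy]; exact hy' x
    | diaIntro a =>
      obtain ⟨y, hy, hy'⟩ := K.exists_val_dia a
      refine hx.imp_eq_one.2 ?_
      rw [hy]; exact hy' x
    | @boxImp ν hν a =>
      obtain ⟨y, hy, hy'⟩ := K.exists_val_box a
      obtain ⟨z, hz, hz'⟩ := K.exists_val_box (ν ⟹ a)
      refine hx.imp_eq_one.2 ?_
      have h1 := (K.isHom y).imp ν a
      have h2 := hx.imp ν (◻a)
      simp only [hy] at h2
      rw [hz, h2, K.val_modal hν x y, ← h1]
      exact hz' y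
    | @impDia ν hν a =>
      obtain ⟨y, hy, hy'⟩ := K.exists_val_dia a
      obtain ⟨z, hz, hz'⟩ := K.exists_val_box (a ⟹ ν)
      refine hx.imp_eq_one.2 ?_
      have h1 := (K.isHom y).imp a ν
      have h2 := hx.imp (◇a) ν
      simp only [hy] at h2
      rw [hz, h2, K.val_modal hν x y, ← h1]
      exact hz' y
    | @boxOr ν hν a =>
      obtain ⟨y, hy, hy'⟩ := K.exists_val_box a
      obtain ⟨z, hz, hz'⟩ := K.exists_val_box (a ⋎ ν)
      refine hx.imp_eq_one.2 ?_
      have h1 := (K.isHom y).or a ν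
      have h2 := hx.or (◻a) ν
      simp only [hy] at h2
      rw [hz, h2, K.val_modal hν x y, ← h1]
      exact hz' y
    | diaSq a =>
      obtain ⟨y, hy, hy'⟩ := K.exists_val_dia a
      obtain ⟨z, hz, hz'⟩ := K.exists_val_dia (a ⊛ a)
      refine hx.equ_eq_one.2 ?_
      have h0 := hx.mul (◇a) (◇a)
      simp only [hy] at h0
      have h1 := (K.isHom y).mul a a
      have h2 := (K.isHom z).mul a a
      rw [hz, h0]
      refine le_antisymm ?_ ?_
      · rw [h2]
        have : (K.val a z : ℝ) ≤ K.val a y := hy' z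
        exact max_le_max le_rfl (by linarith)
      · rw [← h1]; exact hz' y
  | width φ =>
    choose f hf hf' using fun i => K.exists_val_box (φ i)
    have hlt : Cardinal.mk K.X < Cardinal.mk (ULift.{u} (Fin (k + 1))) := by
      refine hk.trans_lt ?_
      simp only [Cardinal.mk_uLift, Cardinal.mk_fin, Cardinal.lift_natCast]
      exact_mod_cast Nat.lt_succ_self k
    have hni : ¬ Function.Injective fun i : ULift.{u} (Fin (k + 1)) => f i.down := fun hinj =>
      absurd (Cardinal.mk_le_of_injective hinj) (not_le.2 hlt)
    have : ∃ i j : Fin (k + 1), i < j ∧ f i = f j := by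
      simp only [Function.Injective, not_forall] at hni
      obtain ⟨⟨i⟩, ⟨j⟩, hij, hne⟩ := hni
      rcases lt_trichotomy i j with h | h | h
      · exact ⟨i, j, h, hij⟩
      · exact absurd (by rw [h]) hne
      · exact ⟨j, i, h, hij.symm⟩
    obtain ⟨i, j, hij, hfij⟩ := this
    refine hx.imp_eq_one.2 ?_
    refine (hx.bigAnd_le (a := ◻(φ i ⋎ φ j)) ?_).trans ?_
    · simp only [List.mem_flatMap, List.mem_map, List.mem_filter]
      exact ⟨i, List.mem_finRange i, j, ⟨List.mem_finRange j, by simpa using hij⟩, rfl⟩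
    · obtain ⟨z, hz, hz'⟩ := K.exists_val_box (φ i ⋎ φ j)
      have h1 : (K.val (φ i ⋎ φ j) z : ℝ) ≤ K.val (φ i ⋎ φ j) (f i) := hz' (f i)
      have h2 := (K.isHom (f i)).or (φ i) (φ j)
      have h3 : ∀ i, (K.val (φ i) (f i) : ℝ) ≤
          K.val (Fm.bigOr ((List.finRange (k + 1)).map fun i => ◻(φ i))) x := fun i =>
        (congrArg Subtype.val (hf i x)).ge.trans
          (hx.le_bigOr (List.mem_map_of_mem (f := fun i => ◻(φ i)) (List.mem_finRange i)))
      rw [hz]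
      refine h1.trans (h2.le.trans (max_le (h3 i) ?_))
      rw [hfij]; exact h3 j

theorem val_rule [Finite K.X] {P : Set (Fm V)} {φ : Fm V} (h : IsRule P φ)
    (hP : ∀ a ∈ P, ∀ x, (K.val a x : ℝ) = 1) (x : K.X) : (K.val φ x : ℝ) = 1 := by
  have hx := K.isHom x
  cases h with
  | mp a _ =>
    have h1 := hx.imp_eq_one.1 (hP (a ⟹ φ) (by simp) x)
    exact le_antisymm (hx.le_one _) ((hP a (by simp) x).ge.trans h1)
  | nec a =>
    obtain ⟨y, hy, -⟩ := K.exists_val_box a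
    rw [hy]; exact hP a rfl y
  | boxInf a b c =>
    have h1 : ∀ n : ℕ, max (K.val (◻a) x : ℝ) (K.val (◻b ⟹ Fm.pow (◻c) n) x) = 1 := fun n =>
      (hx.or _ _).symm.trans (hP _ ⟨n, rfl⟩ x)
    refine (hx.or _ _).trans ?_
    by_cases ha : (K.val (◻a) x : ℝ) = 1
    · rw [ha]; exact max_eq_left (hx.le_one _)
    have ha' : (K.val (◻a) x : ℝ) < 1 := lt_of_le_of_ne (hx.le_one _) ha
    have h2 : ∀ n : ℕ, (K.val (◻b) x : ℝ) ≤ K.val (Fm.pow (◻c) n) x := by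
      intro n
      refine hx.imp_eq_one.1 ?_
      rcases max_choice (K.val (◻a) x : ℝ) (K.val (◻b ⟹ Fm.pow (◻c) n) x) with h | h
      · exact absurd (h.symm.trans (h1 n)) ha
      · exact h.symm.trans (h1 n)
    refine le_antisymm (max_le (hx.le_one _) (hx.le_one _)) (le_max_of_le_right ?_)
    refine (hx.imp_eq_one.2 ?_).ge
    have hm := hx.mul (◻b) (◻c)
    rw [hm]
    by_cases hc : (K.val (◻c) x : ℝ) = 1
    · rw [hc]; exact le_max_of_le_right (by linarith)
    · have hc' : 0 < 1 - (K.val (◻c) x : ℝ) :=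
        sub_pos.2 (lt_of_le_of_ne (hx.le_one _) hc)
      obtain ⟨n, hn⟩ := exists_nat_ge (1 / (1 - (K.val (◻c) x : ℝ)))
      rw [div_le_iff₀ hc'] at hn
      refine le_max_of_le_left ((h2 n).trans ((hx.pow_le (◻c) n).trans ?_))
      exact max_le le_rfl (by linarith)

end Struc

theorem Provable.sound {k : ℕ} {Γ : Set (Fm V)} {φ : Fm V} (h : Provable k Γ φ)
    (K : Struc.{u} V) (hk : Cardinal.mk K.X ≤ (k : Cardinal.{u})) (hΓ : K.IsModel Γ) (x : K.X) :
    K.val φ x = 1 := by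
  have : Finite K.X := Cardinal.lt_aleph0_iff_finite.1 (hk.trans_lt (Cardinal.natCast_lt_aleph0))
  obtain ⟨ξ, ψ, hlast, hstep⟩ := h
  suffices H : ∀ i ≤ ξ, ∀ x, (K.val (ψ i) x : ℝ) = 1 by
    rw [← hlast]; exact Subtype.ext (H ξ le_rfl x)
  intro i
  induction i using WellFoundedLT.induction with
  | _ i ih =>
    intro hi x
    rcases hstep i hi with h | h | ⟨P, hP, hsub⟩
    · exact K.val_ax hk h x
    · exact congrArg Subtype.val (hΓ _ h x)
    · refine K.val_rule hP (fun a ha => ?_) x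
      obtain ⟨j, hj, rfl⟩ := hsub ha
      exact ih j hj ((le_of_lt hj).trans hi)

/-! Closure of provability under the rules -/

theorem IsRule.exists_range {P : Set (Fm V)} {φ : Fm V} (h : IsRule P φ) :
    ∃ f : ℕ → Fm V, P = Set.range f := by
  cases h with
  | mp a _ =>
    refine ⟨fun n => if n = 0 then a else a ⟹ φ, ?_⟩
    ext b
    constructor
    · rintro (rfl | rfl)
      · exact ⟨0, rfl⟩
      · exact ⟨1, rfl⟩
    · rintro ⟨n, rfl⟩
      by_cases h : n = 0 <;> simp [h]
  | nec a => exact ⟨fun _ => a, by simp⟩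
  | boxInf a b c => exact ⟨_, rfl⟩

theorem Provable.of_mem {k : ℕ} {Γ : Set (Fm V)} {φ : Fm V} (h : S5kAx k φ ∨ φ ∈ Γ) :
    Provable k Γ φ :=
  ⟨0, fun _ => φ, rfl, fun _ _ => h.imp_right Or.inl⟩

theorem Provable.of_rule {k : ℕ} {Γ P : Set (Fm V)} {φ : Fm V} (hr : IsRule P φ)
    (hP : ∀ a ∈ P, Provable k Γ a) : Provable k Γ φ := by
  obtain ⟨f, rfl⟩ := hr.exists_range
  choose ξ ψ hψ using fun n => hP (f n) ⟨n, rfl⟩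
  let ζ : Ordinal.{0} := Order.succ (⨆ n, ξ n)
  have hξ : ∀ n, ξ n < ζ := fun n => Order.lt_succ_iff.2 (Ordinal.le_iSup ξ n)
  have hζ : ζ ≠ 0 := (zero_le.trans_lt (hξ 0)).ne'
  let N : Ordinal.{0} → ℕ := fun i => Cardinal.toNat (i / ζ).card
  let χ : Ordinal.{0} → Fm V := fun i =>
    if i < ζ * Ordinal.omega0 then ψ (N i) (min (i % ζ) (ξ (N i))) else φ
  have hlt : ∀ (n : ℕ) (r : Ordinal.{0}), r < ζ → ζ * n + r < ζ * Ordinal.omega0 := by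
    intro n r hr
    calc ζ * n + r < ζ * n + ζ := by gcongr
      _ = ζ * ((n + 1 : ℕ) : Ordinal.{0}) := by push_cast; rw [mul_add, mul_one]
      _ ≤ ζ * Ordinal.omega0 := by gcongr; exact (Ordinal.natCast_lt_omega0 _).le
  have hχ : ∀ (n : ℕ) (r : Ordinal.{0}), r < ζ → χ (ζ * n + r) = ψ n (min r (ξ n)) := by
    intro n r hr
    have h1 : N (ζ * n + r) = n := by
      simp only [N]
      rw [Ordinal.mul_add_div _ hζ, Ordinal.div_eq_zero_of_lt hr]
      simp
    have h2 : (ζ * n + r) % ζ = r := by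
      rw [Ordinal.mul_add_mod_self, Ordinal.mod_eq_of_lt hr]
    simp only [χ, if_pos (hlt n r hr), h1, h2]
  refine ⟨ζ * Ordinal.omega0, χ, if_neg (lt_irrefl _), fun i hi => ?_⟩
  rcases hi.lt_or_eq with hi | rfl
  · obtain ⟨n, hn⟩ := Ordinal.lt_omega0.1 ((Ordinal.lt_mul_iff_div_lt hζ).1 hi)
    have hr : i % ζ < ζ := Ordinal.mod_lt _ hζ
    have hi' : i = ζ * n + i % ζ := by rw [← hn, Ordinal.div_add_mod]
    have e := hχ n _ hr
    rw [← hi'] at e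
    rw [e]
    refine ((hψ n).step _ (min_le_right _ _)).imp_right (Or.imp_right ?_)
    rintro ⟨P, hP, hsub⟩
    refine ⟨P, hP, fun a ha => ?_⟩
    obtain ⟨j, hj, rfl⟩ := hsub ha
    have hj1 : j < i % ζ := lt_of_lt_of_le hj (min_le_left _ _)
    have hj2 : j < ξ n := lt_of_lt_of_le hj (min_le_right _ _)
    refine ⟨ζ * n + j, ?_, ?_⟩
    · rw [Set.mem_Iio, hi']; gcongr
    · rw [hχ n j (hj1.trans hr), min_eq_left hj2.le]
  · refine Or.inr (Or.inr ⟨_, (by simpa only [χ, lt_irrefl, if_false] using hr), ?_⟩)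
    rintro _ ⟨n, rfl⟩
    refine ⟨ζ * n + ξ n, hlt n _ (hξ n), ?_⟩
    rw [hχ n _ (hξ n), min_self, (hψ n).last]

/-! Completeness -/

/-- Theories of `S5_k(Ł)_∞`. -/
structure IsModalTheory (k : ℕ) (T : Set (Fm V)) : Prop where
  ax {φ : Fm V} : S5kAx k φ → φ ∈ T
  rule {P : Set (Fm V)} {φ : Fm V} : IsRule P φ → P ⊆ T → φ ∈ T

theorem isModalTheory_provable (k : ℕ) (Γ : Set (Fm V)) :
    IsModalTheory k {φ | Provable k Γ φ} where
  ax h := Provable.of_mem (Or.inl h)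
  rule h h' := Provable.of_rule h h'

theorem IsTheory.imp_imp_self {T : Set (Fm V)} (hT : IsTheory T) {a b : Fm V}
    (h : (b ⟹ a) ∈ T) : (((a ⟹ b) ⟹ b) ⟹ a) ∈ T := by
  refine hT.trans hT.imp_iff_neg.1 (hT.trans (hT.neg_mono ?_) hT.dne)
  have h1 : (a.neg ⟹ a.neg ⊛ (a.neg ⟹ b.neg)) ∈ T := hT.imp_and hT.refl (hT.neg_mono h)
  refine hT.trans h1 (hT.trans (hT.ax (.a4 _ _)) (hT.trans hT.mul_comm (hT.mul_mono_left ?_)))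
  exact hT.trans hT.swap_imp (hT.imp_mono_right hT.dne)

namespace IsModalTheory

variable {k : ℕ} {T : Set (Fm V)} (hT : IsModalTheory k T)

include hT

theorem isTheory : IsTheory T where
  ax h := hT.ax (.s5 (.luk h))
  mp {a b} h h' := hT.rule (.mp a b) (by rintro _ (rfl | rfl) <;> assumption)

theorem nec {a : Fm V} (h : a ∈ T) : ◻a ∈ T := hT.rule (.nec a) (by rintro _ rfl; exact h)

theorem box_elim (a : Fm V) : (◻a ⟹ a) ∈ T := hT.ax (.s5 (.boxElim a))

theorem dia_intro (a : Fm V) : (a ⟹ ◇a) ∈ T := hT.ax (.s5 (.diaIntro a))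

theorem modal_imp_box {ν a : Fm V} (hν : IsModalComb ν) (h : (ν ⟹ a) ∈ T) : (ν ⟹ ◻a) ∈ T :=
  hT.isTheory.mp (hT.ax (.s5 (.boxImp hν a))) (hT.nec h)

theorem box_mono {a b : Fm V} (h : (a ⟹ b) ∈ T) : (◻a ⟹ ◻b) ∈ T :=
  hT.modal_imp_box (.box a) (hT.isTheory.trans (hT.box_elim a) h)

end IsModalTheory

/-- Homomorphisms to the standard MV-algebra that map `T` to `1`. -/
structure IsHomOn (T : Set (Fm V)) (g : Fm V → ℝ) : Prop extends IsHom g where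
  mem {a : Fm V} : a ∈ T → g a = 1

namespace IsHomOn

variable {k : ℕ} {T : Set (Fm V)} {h g : Fm V → ℝ}

theorem le (hh : IsHomOn T h) {a b : Fm V} (hab : (a ⟹ b) ∈ T) : h a ≤ h b :=
  hh.imp_eq_one.1 (hh.mem hab)

theorem box_le (hT : IsModalTheory k T) (hh : IsHomOn T h) (a : Fm V) : h (◻a) ≤ h a :=
  hh.le (hT.box_elim a)

theorem dia_eq (hT : IsModalTheory k T) (hh : IsHomOn T h) (a : Fm V) :
    h (◇a) = 1 - h (◻a.neg) := by
  have h1 : h a.dia.neg ≤ h (◻a.neg) := hh.le (hT.modal_imp_box (.imp (.dia a) .bot)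
    (hT.isTheory.neg_mono (hT.dia_intro a)))
  have h2 : h (◻a.neg) ≤ h a.dia.neg := hh.le (hT.ax (.s5 (.impDia .bot a)))
  rw [hh.neg] at h1 h2
  linarith

theorem box_dbl (hT : IsModalTheory k T) (hh : IsHomOn T h) {a : Fm V} (h0 : h (◻a) = 0) :
    h (◻(a.neg ⟹ a)) = 0 := by
  have h1 := hh.le (hT.box_mono (hT.isTheory.imp_iff_neg (a := a.neg) (b := a)).1)
  have h2 := hh.dia_eq hT (a.neg ⊛ a.neg)
  have h3 := hh.equ_eq_one.1 (hh.mem (hT.ax (.s5 (.diaSq a.neg))))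
  have h4 := hh.dia_eq hT a.neg
  have h5 := hh.le (hT.box_mono (hT.isTheory.dne (a := a)))
  have h6 := hh.nonneg (◻a.neg.neg)
  have h7 : h (◻a.neg.neg) = 0 := by linarith
  rw [h7, sub_zero] at h4
  rw [hh.mul, h4] at h3
  norm_num at h3
  refine le_antisymm ?_ (hh.nonneg _)
  linarith

theorem box_mul_neg_box (hT : IsModalTheory k T) (hh : IsHomOn T h) (a : Fm V) :
    h (◻(a ⊛ (◻a).neg)) = 0 := by
  have hT' := hT.isTheory
  set ν := ◇(a ⟹ ◻a) with hν
  have h1 : ((ν ⟹ ◻a) ⟹ ◻a) ∈ T := hT.modal_imp_box (.imp (.dia _) (.box a))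
    (hT'.trans (hT'.imp_mono_left (hT.dia_intro _)) (hT'.imp_imp_self (hT.box_elim a)))
  have h2 : (◻a ⟹ ν) ∈ T := hT'.trans (hT'.mul_imp_iff.1 hT'.mul_left) (hT.dia_intro _)
  have h3 : h ν = 1 := by
    have h1 := hh.le h1
    have h2 := hh.le h2
    rw [hh.imp] at h1
    have := hh.le_one ν
    rcases min_cases 1 (1 - h ν + h (◻a)) with h' | h' <;> linarith
  have h4 := hh.dia_eq hT (a ⟹ ◻a)
  have h5 : h (◻(a ⊛ (◻a).neg)) ≤ h (◻(a ⟹ ◻a).neg) :=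
    hh.le (hT.box_mono (hT'.trans hT'.dni (hT'.neg_mono hT'.imp_iff_neg.1)))
  have := hh.nonneg (◻(a ⊛ (◻a).neg))
  rw [← hν] at h4
  linarith

/-- A homomorphism on modal combinations is determined by where it takes the value `1`. -/
theorem eq_of_one (hh : IsHom h) (hg : IsHom g)
    (H : ∀ κ, IsModalComb κ → h κ = 1 → g κ = 1) {κ : Fm V} (hκ : IsModalComb κ) :
    g κ = h κ := by
  refine MVChain.eq_of_forall_abs_le fun n => ?_
  induction n generalizing κ with
  | zero =>
    have := hg.nonneg κ; have := hg.le_one κ; have := hh.nonneg κ; have := hh.le_one κ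
    rw [abs_le]; constructor <;> norm_num <;> linarith
  | succ n ih =>
    have m1 : IsModalComb (κ.neg ⟹ κ) := .imp (.imp hκ .bot) hκ
    have m2 : IsModalComb (κ ⟹ κ.neg) := .imp hκ (.imp hκ .bot)
    rcases le_total (h κ) (1 / 2) with hle | hle
    · have h1 := H _ m2 (hh.imp_eq_one.2 (by rw [hh.neg]; linarith))
      rw [hg.imp_eq_one, hg.neg] at h1
      have h2 := ih m1
      rw [hg.imp, hh.imp, hg.neg, hh.neg, min_eq_right (by linarith), min_eq_right (by linarith),
        abs_le] at h2
      rw [pow_succ, abs_le]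
      constructor <;> linarith
    · have h1 := H _ m1 (hh.imp_eq_one.2 (by rw [hh.neg]; linarith))
      rw [hg.imp_eq_one, hg.neg] at h1
      have h2 := ih (hκ.mul hκ)
      rw [hg.mul, hh.mul, max_eq_right (by linarith), max_eq_right (by linarith), abs_le] at h2
      rw [pow_succ, abs_le]
      constructor <;> linarith

theorem iterate_dbl (hg : IsHom g) (m : ℕ) (a : Fm V) :
    g ((fun b : Fm V => b.neg ⟹ b)^[m] a) = min 1 (2 ^ m * g a) := by
  induction m with
  | zero => simp [hg.le_one]
  | succ m ih =>
    rw [Function.iterate_succ_apply', hg.imp, hg.neg, ih, pow_succ]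
    have : 0 ≤ 2 ^ m * g a := mul_nonneg (by positivity) (hg.nonneg a)
    rcases min_cases 1 (2 ^ m * g a) with h' | h' <;> rw [h'.1]
    · rw [min_eq_left, min_eq_left] <;> linarith
    · congr 1; ring

/-- A prime theory containing `T` yields a homomorphism. -/
theorem _root_.S5Luk.IsTheory.exists_isHomOn {U : Set (Fm V)} {d : Fm V} (hU : IsTheory U)
    (hTU : T ⊆ U) (hd : d ∉ U) : ∃ g, IsHomOn T g ∧ (∀ a ∈ U, g a = 1) ∧
      ∀ a b, (b ⟹ a) = d → g a ≤ g b := by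
  obtain ⟨P, hP, hUP, hdP, hlin⟩ := hU.exists_prime hd
  obtain ⟨g, hg, hle⟩ := hP.exists_hom hlin fun hb => hdP (hP.mp hP.bot_imp hb)
  have h1 : ∀ a ∈ U, g a = 1 := fun a ha =>
    le_antisymm (hg.le_one a) (hg.top.ge.trans (hle _ _ (hP.weaken (hUP ha))))
  refine ⟨g, ⟨hg, fun ha => h1 _ (hTU ha)⟩, h1, ?_⟩
  rintro a b rfl
  exact hle _ _ ((hlin a b).resolve_right hdP)

/-- The homomorphisms on `T` that agree with `h` on modal combinations. -/
def _root_.S5Luk.homFiber (T : Set (Fm V)) (h : Fm V → ℝ) : Set (Fm V → ℝ) :=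
  {g | IsHomOn T g ∧ ∀ κ, IsModalComb κ → g κ = h κ}

/-- The value of `◻a` is the infimum of the values of `a` in the fiber. -/
theorem exists_le_box_add (hT : IsModalTheory k T) (hh : IsHomOn T h) (a : Fm V) {ε : ℝ}
    (hε : 0 < ε) : ∃ g ∈ homFiber T h, g a < h (◻a) + ε := by
  have hT' := hT.isTheory
  let U : Set (Fm V) := {ψ | ∃ κ, IsModalComb κ ∧ h κ = 1 ∧ (κ ⟹ ψ) ∈ T}
  have hTU : T ⊆ U := fun ψ hψ =>
    ⟨Fm.top, .imp .bot .bot, hh.top, hT'.weaken hψ⟩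
  have hU : IsTheory U := by
    refine ⟨fun hψ => hTU (hT'.ax hψ), ?_⟩
    rintro b c ⟨κ, hκ, hκ1, hbc⟩ ⟨μ, hμ, hμ1, hb⟩
    refine ⟨κ ⊛ μ, hκ.mul hμ, by rw [hh.mul, hκ1, hμ1]; norm_num, ?_⟩
    exact hT'.trans (hT'.mul_mono hbc hb) (hT'.mul_imp_iff.2 hT'.refl)
  have hmem : ∀ {κ : Fm V}, IsModalComb κ → h κ = 1 → κ ∈ U := fun {κ} hκ hκ1 =>
    ⟨κ, hκ, hκ1, hT'.refl⟩
  obtain ⟨m, hm⟩ := exists_pow_lt_of_lt_one hε (by norm_num : (1 / 2 : ℝ) < 1)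
  set d := a ⊛ (◻a).neg with hd
  let D : ℕ → Fm V := fun n => (fun b : Fm V => b.neg ⟹ b)^[n] d
  have hD0 : ∀ n, h (◻(D n)) = 0 := by
    intro n
    induction n with
    | zero => exact hh.box_mul_neg_box hT a
    | succ n ih =>
      simp only [D] at ih ⊢
      rw [Function.iterate_succ_apply']
      exact hh.box_dbl hT ih
  have hDU : D (m + 1) ∉ U := by
    rintro ⟨κ, hκ, hκ1, hκD⟩
    have := hh.le (hT.modal_imp_box hκ hκD)
    rw [hκ1, hD0] at this
    linarith
  obtain ⟨g, hg, hgU, hgD⟩ := hU.exists_isHomOn hTU hDU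
  have hagree : ∀ κ, IsModalComb κ → g κ = h κ := fun κ hκ =>
    eq_of_one hh.toIsHom hg.toIsHom (fun κ hκ h1 => hgU κ (hmem hκ h1)) hκ
  refine ⟨g, ⟨hg, hagree⟩, ?_⟩
  have h1 := hgD (D m) (D m).neg (by simp only [D]; rw [Function.iterate_succ_apply'])
  rw [hg.neg] at h1
  have h2 : g (D m) = min 1 (2 ^ m * g d) := iterate_dbl hg.toIsHom m d
  have h3 : 2 ^ m * g d < 1 := by
    rcases min_cases 1 (2 ^ m * g d) with h' | h' <;> linarith
  have h4 : g d < (1 / 2) ^ m := by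
    have h5 : (1 / 2 : ℝ) ^ m * 2 ^ m = 1 := by rw [← mul_pow]; norm_num
    have h6 : (0 : ℝ) < (1 / 2) ^ m := by positivity
    calc g d = (1 / 2) ^ m * (2 ^ m * g d) := by rw [← mul_assoc, h5, one_mul]
      _ < (1 / 2) ^ m * 1 := by gcongr
      _ = (1 / 2) ^ m := mul_one _
  have h5 : g a - g (◻a) ≤ g d := by
    rw [hd, hg.mul, hg.neg]
    exact le_max_of_le_right (by linarith)
  rw [hagree _ (.box a)] at h5
  linarith

theorem separation (hh : IsHom h) (hg : IsHom g) {a : Fm V} (hlt : h a < g a) :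
    ∃ c, h c < 1 / 2 ∧ 1 / 2 < g c := by
  obtain ⟨n, hn⟩ := exists_pow_lt_of_lt_one (sub_pos.2 hlt) (by norm_num : (1 / 2 : ℝ) < 1)
  induction n generalizing a with
  | zero => simp at hn; linarith [hg.le_one a, hh.nonneg a]
  | succ n ih =>
    rw [pow_succ] at hn
    rcases le_or_gt (g a) (1 / 2) with h1 | h1
    · have e1 : g (a.neg ⟹ a) = 2 * g a := by
        rw [hg.imp, hg.neg, min_eq_right] <;> linarith
      have e2 : h (a.neg ⟹ a) = 2 * h a := by
        rw [hh.imp, hh.neg, min_eq_right] <;> linarith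
      exact ih (a := a.neg ⟹ a) (by linarith) (by linarith)
    rcases le_or_gt (1 / 2) (h a) with h2 | h2
    · have e1 : g (a ⊛ a) = 2 * g a - 1 := by
        rw [hg.mul, max_eq_right] <;> linarith
      have e2 : h (a ⊛ a) = 2 * h a - 1 := by
        rw [hh.mul, max_eq_right] <;> linarith
      exact ih (a := a ⊛ a) (by linarith) (by linarith)
    · exact ⟨a, h2, h1⟩

theorem separation_of_ne (hh : IsHom h) (hg : IsHom g) (hne : h ≠ g) :
    ∃ c, h c < 1 / 2 ∧ 1 / 2 < g c := by
  obtain ⟨a, ha⟩ := Function.ne_iff.1 hne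
  rcases lt_or_gt_of_ne ha with h1 | h1
  · exact separation hh hg h1
  · exact separation hh hg (a := a.neg) (by rw [hh.neg, hg.neg]; linarith)

/-- The schema `(W_k)` bounds the size of the fibers. -/
theorem not_injective (hT : IsModalTheory k T) (hh : IsHomOn T h)
    (f : Fin (k + 1) → homFiber T h) : ¬ Function.Injective f := by
  intro hf
  have hsep : ∀ i j : Fin (k + 1), ∃ c, i ≠ j → (f j).1 c < 1 / 2 ∧ 1 / 2 < (f i).1 c := by
    intro i j
    by_cases hij : i = j
    · exact ⟨Fm.bot, fun h => absurd hij h⟩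
    · obtain ⟨c, hc⟩ := separation_of_ne (f j).2.1.toIsHom (f i).2.1.toIsHom
        fun h => hij (hf (Subtype.ext h.symm))
      exact ⟨c, fun _ => hc⟩
  choose c hc using hsep
  let φ : Fin (k + 1) → Fm V := fun i =>
    Fm.bigOr (((List.finRange (k + 1)).filter fun j => j ≠ i).map fun j => c i j ⟹ c j i)
  have h1 : ∀ i, (f i).1 (φ i) < 1 := by
    intro i
    refine (f i).2.1.bigOr_lt_one fun a ha => ?_
    obtain ⟨j, hj, rfl⟩ := List.mem_map.1 ha
    have hji : j ≠ i := by simpa using (List.mem_filter.1 hj).2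
    have h1 := (hc i j hji.symm).2
    have h2 := (hc j i hji).1
    refine lt_of_le_of_ne ((f i).2.1.le_one _) fun h3 => ?_
    have := (f i).2.1.imp_eq_one.1 h3
    linarith
  have h2 : ∀ i j, i < j → h (◻(φ i ⋎ φ j)) = 1 := by
    intro i j hij
    by_contra hne
    have hlt : h (◻(φ i ⋎ φ j)) < 1 := lt_of_le_of_ne (hh.le_one _) hne
    obtain ⟨g, hg, hg'⟩ := hh.exists_le_box_add hT (φ i ⋎ φ j) (sub_pos.2 hlt)
    rw [hg.1.or] at hg'
    have e1 : g (c i j ⟹ c j i) ≤ g (φ i) := hg.1.le_bigOr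
      (List.mem_map.2 ⟨j, List.mem_filter.2 ⟨List.mem_finRange j, by simpa using hij.ne'⟩, rfl⟩)
    have e2 : g (c j i ⟹ c i j) ≤ g (φ j) := hg.1.le_bigOr
      (List.mem_map.2 ⟨i, List.mem_filter.2 ⟨List.mem_finRange i, by simpa using hij.ne⟩, rfl⟩)
    have e3 := le_max_left (g (φ i)) (g (φ j))
    have e4 := le_max_right (g (φ i)) (g (φ j))
    rcases le_total (g (c i j)) (g (c j i)) with h' | h'
    · have := hg.1.imp_eq_one.2 h'; linarith
    · have := hg.1.imp_eq_one.2 h'; linarith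
  have h3 := hh.le (hT.ax (.width φ))
  rw [hh.bigAnd_eq_one] at h3
  · refine absurd h3 (not_le.2 (hh.bigOr_lt_one fun a ha => ?_))
    obtain ⟨i, -, rfl⟩ := List.mem_map.1 ha
    rw [← (f i).2.2 _ (.box (φ i))]
    exact ((f i).2.1.box_le hT _).trans_lt (h1 i)
  · intro a ha
    simp only [List.mem_flatMap, List.mem_map, List.mem_filter] at ha
    obtain ⟨i, -, j, ⟨-, hij⟩, rfl⟩ := ha
    exact h2 i j (by simpa using hij)

end IsHomOn

/-- The infinitary rule makes the modal combinations Archimedean. -/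
theorem IsModalTheory.exists_isHomOn {k : ℕ} {T : Set (Fm V)} (hT : IsModalTheory k T)
    {φ : Fm V} (hφ : φ ∉ T) : ∃ h, IsHomOn T h ∧ h (◻φ) < 1 := by
  have hT' := hT.isTheory
  have hn : ∃ n : ℕ, (◻(◻φ).neg ⟹ Fm.pow (◻φ) n) ∉ T := by
    by_contra! hcon
    have h1 := hT.rule (.boxInf Fm.bot (◻φ).neg φ) (by
      rintro _ ⟨n, rfl⟩
      exact hT'.mp hT'.imp_or_right (hcon n))
    have h2 : (◻(◻φ).neg ⟹ ◻(◻φ).neg ⊛ ◻φ) ∈ T := hT'.mp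
      (hT'.or_imp (hT'.trans (hT.box_elim _) hT'.bot_imp) hT'.refl) h1
    have h3 : ((◻φ).neg ⟹ ◻(◻φ).neg) ∈ T := hT.modal_imp_box (.imp (.box φ) .bot) hT'.refl
    have h4 : (◻(◻φ).neg ⊛ ◻φ ⟹ Fm.bot) ∈ T := hT'.mul_imp_iff.2 (hT.box_elim _)
    exact hφ (hT'.mp (hT.box_elim φ) (hT'.mp hT'.dne (hT'.trans h3 (hT'.trans h2 h4))))
  obtain ⟨n, hn⟩ := hn
  obtain ⟨h, hh, -, hle⟩ := hT'.exists_isHomOn subset_rfl hn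
  refine ⟨h, hh, lt_of_le_of_ne (hh.le_one _) fun h1 => ?_⟩
  have h2 := hle _ _ rfl
  have h3 := hh.box_le hT (◻φ).neg
  rw [hh.pow_eq_one h1] at h2
  rw [hh.neg, h1] at h3
  linarith

section Model

variable {k : ℕ} {T : Set (Fm V)} {h : Fm V → ℝ}

/-- In a finite structure whose points run through a fiber, formulas take at each point the value
given by the corresponding homomorphism. -/
theorem val_eq_of_surjective (hT : IsModalTheory k T) (hh : IsHomOn T h) (K : Struc.{u} V)
    [Finite K.X] (f : K.X → homFiber T h) (hf : Function.Surjective f)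
    (he : ∀ x p, (K.e x p : ℝ) = (f x).1 (.var p)) (φ : Fm V) (i : K.X) :
    (K.val φ i : ℝ) = (f i).1 φ := by
  have box : ∀ a : Fm V, (∀ i, (K.val a i : ℝ) = (f i).1 a) →
      ∀ i, (K.val (◻a) i : ℝ) = (f i).1 (◻a) := by
    intro a ih i
    obtain ⟨j, hj, hj'⟩ := K.exists_val_box a
    rw [hj, (f i).2.2 _ (.box a)]
    refine le_antisymm (le_of_forall_pos_lt_add fun ε hε => ?_) ?_
    · obtain ⟨g, hg, hlt⟩ := hh.exists_le_box_add hT a hε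
      obtain ⟨l, hl⟩ := hf ⟨g, hg⟩
      have h1 : (K.val a j : ℝ) ≤ K.val a l := hj' l
      rw [ih l, hl] at h1
      exact h1.trans_lt hlt
    · exact ((f j).2.2 _ (.box a)).ge.trans (((f j).2.1.box_le hT a).trans (ih j).ge)
  induction φ generalizing i with
  | var p => exact he i p
  | bot => exact (f i).2.1.bot.symm
  | mul a b iha ihb =>
    rw [(f i).2.1.mul, ← iha, ← ihb]; exact (K.isHom i).mul a b
  | imp a b iha ihb =>
    rw [(f i).2.1.imp, ← iha, ← ihb]; exact (K.isHom i).imp a b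
  | box a ih => exact box a ih i
  | dia a ih =>
    rw [(f i).2.1.dia_eq hT, ← box a.neg (fun i => ?_) i]
    · obtain ⟨j, hj, hj'⟩ := K.exists_val_dia a
      obtain ⟨l, hl, hl'⟩ := K.exists_val_box a.neg
      have e1 := (K.isHom j).neg a
      have e2 := (K.isHom l).neg a
      have e3 : (K.val a.neg l : ℝ) ≤ K.val a.neg j := hl' j
      have e4 : (K.val a l : ℝ) ≤ K.val a j := hj' l
      rw [hj, hl]
      linarith
    · rw [(f i).2.1.neg, ← ih]; exact (K.isHom i).neg a

end Model

/-- A formula outside a theory of `S5_k(Ł)_∞` fails in a model of the theory of size at most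
`k`. -/
theorem IsModalTheory.exists_model {k : ℕ} {T : Set (Fm V)} (hT : IsModalTheory k T)
    {φ : Fm V} (hφ : φ ∉ T) : ∃ K : Struc.{u} V, Cardinal.mk K.X ≤ (k : Cardinal.{u}) ∧
      K.IsModel T ∧ ¬ K.IsModel {φ} := by
  obtain ⟨h, hh, hlt⟩ := hT.exists_isHomOn hφ
  have hcard : Cardinal.mk (homFiber T h) ≤ k := by
    by_contra! hcon
    have h1 : ((k + 1 : ℕ) : Cardinal) ≤ Cardinal.mk (homFiber T h) := by
      rw [Nat.cast_succ, ← Cardinal.succ_natCast]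
      exact Order.succ_le_of_lt hcon
    have h2 : Cardinal.lift (Cardinal.mk (Fin (k + 1))) ≤
        Cardinal.lift.{0} (Cardinal.mk (homFiber T h)) := by simpa using h1
    obtain ⟨f⟩ := Cardinal.lift_mk_le'.1 h2
    exact hh.not_injective hT f f.injective
  have : Finite (homFiber T h) :=
    Cardinal.lt_aleph0_iff_finite.1 (hcard.trans_lt (Cardinal.natCast_lt_aleph0))
  obtain ⟨n, ⟨e⟩⟩ := Finite.exists_equiv_fin (homFiber T h)
  let f : ULift.{u} (Fin n) → homFiber T h := fun i => e.symm i.down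
  have hf : Function.Surjective f := fun g => ⟨⟨e g⟩, e.symm_apply_apply g⟩
  have : Nonempty (ULift.{u} (Fin n)) := ⟨⟨e ⟨h, hh, fun _ _ => rfl⟩⟩⟩
  let K : Struc.{u} V := ⟨ULift.{u} (Fin n), this, fun i p =>
    ⟨(f i).1 (.var p), (f i).2.1.nonneg _, (f i).2.1.le_one _⟩⟩
  have : Finite K.X := inferInstanceAs (Finite (ULift (Fin n)))
  have hval := val_eq_of_surjective hT hh K f hf fun _ _ => rfl
  refine ⟨K, ?_, fun a ha i => ?_, fun hmod => ?_⟩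
  · have hn : n ≤ k := by
      have h1 := Cardinal.lift_mk_eq'.2 ⟨e⟩
      have h2 := Cardinal.lift_le.2 hcard
      rw [h1] at h2
      simpa using h2
    simpa [K] using hn
  · exact Subtype.ext ((hval a i).trans ((f i).2.1.mem ha))
  · obtain ⟨g, hg, hg'⟩ := hh.exists_le_box_add hT φ (sub_pos.2 hlt)
    obtain ⟨i, hi⟩ := hf ⟨g, hg⟩
    have h1 := hval φ i
    rw [hmod φ rfl i, hi] at h1
    have h2 : g φ = 1 := h1.symm
    linarith

end S5Luk

theorem mainTheorem4 {V : Type v} [Countable V] [Infinite V] (k : ℕ)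
    (Γ : Set (S5Luk.Fm V)) (φ : S5Luk.Fm V) :
    S5Luk.Provable k Γ φ ↔ S5Luk.Entails.{u, v} k Γ φ := by
  refine ⟨fun h K hk hΓ ψ hψ x => ?_, fun h => ?_⟩
  · rw [Set.mem_singleton_iff.1 hψ]
    exact h.sound K hk hΓ x
  · by_contra hφ
    obtain ⟨K, hk, hK, hn⟩ := (S5Luk.isModalTheory_provable k Γ).exists_model (φ := φ) hφ
    exact hn (h K hk fun ψ hψ => hK ψ (S5Luk.Provable.of_mem (Or.inr hψ)))
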